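/- Write $\nabla^\perp=(-\partial_2,\partial_1)$ and, for a vorticity $w$ on $\mathbb R^2$, let $\nabla^\perp\Delta^{-1}w(x)=\frac1{2\pi}\int_{\mathbb R^2}\frac{(x-y)^\perp}{|x-y|^2}\,w(y)\,dy$ with $(a,b)^\perp=(-b,a)$. The vorticity equation is $$\partial_t\omega+u\cdot\nabla\omega=0,\qquad u=\nabla^\perp\Delta^{-1}\omega,\qquad t\ge 0,\ x\in\mathbb R^2 ;$$ solutions are classical: $C^1$ on $[0,\infty)\times\mathbb R^2$, with $\|\omega(t)\|_{L^1}+\|\omega(t)\|_{L^\infty}$ bounded on bounded time intervals. Let $\omega_0^S,\omega_0^L\in C_c^\infty(\mathbb R^2)$ be real-valued with disjoint supports and $\int_{\mathbb R^2}\omega_0^S\,dx=\int_{\mathbb R^2}\omega_0^L\,dx=0$, and put $u_0^S=\nabla^\perp\Delta^{-1}\omega_0^S$, $u_0^L=\nabla^\perp\Delta^{-1}\omega_0^L$. Then there is a sign $\sigma\in\{1,-1\}$, depending only on $\omega_0^S$ and $\omega_0^L$, with the following properties. (1) Let $M>1$ and let $\omega^S+\omega^L$ be a solution of the vorticity equation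 with $\omega^S(0)=\sigma\omega_0^S$, $\omega^L(0)=\omega_0^L$, whose small-scale part is $\omega^S(x,t)=\sigma\,\omega_0^S(Mt\,x_1,(Mt)^{-1}x_2)$ for all $t>0$. Put $u^S=\nabla^\perp\Delta^{-1}\omega^S$, $u^L=\nabla^\perp\Delta^{-1}\omega^L$. Then $u_0^S$, $u_0^L$, $u^S(t)$ and $u^L(t)$ belong to $L^2(\mathbb R^2)$ and $$\left(\|u_0^L\|_{L^2}^2+\|u_0^S\|_{L^2}^2\right)^{1/2}-\|u^S(t)\|_{L^2}\le\|u^L(t)\|_{L^2}\qquad\text{for all } t\ge 0 .$$ (2) Suppose moreover that $\int_{\mathbb R}\omega_0^S(x_1,x_2)\,dx_1=0$ for every $x_2\in\mathbb R$ (for instance, that $\omega_0^S$ is odd in $x_1$). Then for each fixed $t\in(0,1]$ the velocity $u^S(t)=\nabla^\perp\Delta^{-1}\big[\sigma\,\omega_0^S(Mt\,x_1,(Mt)^{-1}x_2)\big]$ belongs to $L^2(\mathbb R^2)$ for every $M>1$, and $$\|u^S(t)\|_{L^2}\to0\qquad\text{as } M\to\infty .$$ -/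

import Mathlib

open MeasureTheory Set Filter Topology
open scoped ContDiff

noncomputable section

/-- The plane with its Euclidean norm. -/
abbrev Plane : Type := EuclideanSpace ℝ (Fin 2)

/-- The kernel of the operator `∇^⊥ Δ⁻¹` on the plane, with `∇^⊥ = (-∂₂, ∂₁)`: the perpendicular
gradient `(2π)⁻¹ (-z₂, z₁) / |z|²` of the fundamental solution `(2π)⁻¹ log |z|`. -/
def biotSavartKernel (z : Plane) : Plane :=
  ((2 * Real.pi)⁻¹ * (‖z‖ ^ 2)⁻¹) • !₂[-z 1, z 0]

/-- The velocity `u = ∇^⊥ Δ⁻¹ w` with vorticity `w = ∂₁ u₂ - ∂₂ u₁` (Biot-Savart law). -/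
def biotSavart (w : Plane → ℝ) (x : Plane) : Plane :=
  ∫ y, w y • biotSavartKernel (x - y)

/-- The `L²` norm of a vector field (meaningful for fields in `L²`). -/
def l2Norm (u : Plane → Plane) : ℝ :=
  (eLpNorm u 2 volume).toReal

/-- The thinned vorticity `x ↦ w (M t x₁, (M t)⁻¹ x₂)`. -/
def thinned (M t : ℝ) (w : Plane → ℝ) (x : Plane) : ℝ :=
  w !₂[M * t * x 0, (M * t)⁻¹ * x 1]

/-- `w` is a classical global solution of the planar Euler equations in vorticity form,
`∂ₜ w + u · ∇w = 0`, `u = ∇^⊥ Δ⁻¹ w`, `w(0) = w₀`. It is continuously differentiable up to the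
initial time, and its `L¹` and sup norms are bounded on bounded time intervals (so that the
Biot-Savart integral converges absolutely). -/
structure IsEulerSolution (w₀ : Plane → ℝ) (w : ℝ → Plane → ℝ) : Prop where
  contDiffOn : ContDiffOn ℝ 1 (fun p : ℝ × Plane => w p.1 p.2) (Ici 0 ×ˢ univ)
  bounds : ∀ T : ℝ, ∃ C : ℝ, ∀ t ∈ Icc 0 T,
    Integrable (w t) ∧ (∫ x, |w t x|) ≤ C ∧ ∀ x, |w t x| ≤ C
  initial : w 0 = w₀
  transport : ∀ t, 0 ≤ t → ∀ x, HasDerivWithinAt (fun s => w s x)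
    (-(fderiv ℝ (w t) x (biotSavart (w t) x))) (Ici 0) t

/-- A splitting `ωS + ωL` of a solution of the Euler equations with initial vorticity
`ωS₀ + ωL₀` into a small-scale part `ωS`, which starts at `ωS₀` and for positive times is thinned,
and a large-scale part `ωL`, which starts at `ωL₀`. -/
structure IsThinningSplitting (M : ℝ) (ωS₀ ωL₀ : Plane → ℝ) (ωS ωL : ℝ → Plane → ℝ) :
    Prop where
  solution : IsEulerSolution (ωS₀ + ωL₀) (fun t => ωS t + ωL t)
  initial_small : ωS 0 = ωS₀
  initial_large : ωL 0 = ωL₀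
  thinning : ∀ t, 0 < t → ωS t = thinned M t ωS₀

end

/-! The kinetic energy of a compactly supported vorticity of mean zero is a quadratic form in the
vorticity: with N(z) = (2π)⁻¹ log |z|, ‖u‖² = -∬ N(x - y) w(x) w(y) dx dy
(`integral_norm_sq_gradPotential`, `l2Norm_biotSavart_sq`, `integral_logKernel_mul_mul`). Both
claims are read off from this formula.

For (1), σ is the sign that makes the L² pairing of σu₀^S with u₀^L nonnegative, so the initial
energy is at least ‖u₀^S‖² + ‖u₀^L‖². Energy is conserved (`IsEulerSolution.l2Norm_biotSavart_eq`),
and the triangle inequality at time t gives the bound (`IsThinningSplitting.le_l2Norm`).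
Conservation is proved as follows. A bounded velocity means finite propagation speed
(`nonpos_of_transport`), so the vorticity stays compactly supported and the double integral may be
differentiated under the integral sign. By symmetry of N its derivative is 2 ∫ ψ ∂ₜω = -2 ∫ ψ u·∇ω
with ψ = Δ⁻¹ω, and this vanishes because u is weakly divergence free and orthogonal to ∇ψ. Replacing
ψ by 1 shows that the mean stays zero, which is what keeps the velocity in L².

For (2), put a = Mt. An area preserving change of variables moves the squeezing from the vorticity
to the kernel, which becomes (4π)⁻¹ (2 log a + log (z₂² + a⁻⁴ z₁²)). The divergent constant 2 log a
is annihilated by the zero mean. The rest converges, by domination, to the energy with kernel log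
z₂², which does not see x₁ and so vanishes when all horizontal integrals of the vorticity do
(`tendsto_anisotropicEnergy`, `anisotropicEnergy_zero`). -/

noncomputable section

/-! ### Kernels and their local integrability. -/

/-- The Newtonian potential `(2π)⁻¹ log |z|` of the plane. -/
def logKernel (z : Plane) : ℝ := (2 * Real.pi)⁻¹ * Real.log ‖z‖

/-- The gradient of the Newtonian potential of the plane. -/
def gradKernel (z : Plane) : Plane := ((2 * Real.pi)⁻¹ * (‖z‖ ^ 2)⁻¹) • z

/-- Rotation by a right angle. -/
def perp : Plane →L[ℝ] Plane :=
  LinearMap.toContinuousLinearMap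
    { toFun := fun v => !₂[-v 1, v 0]
      map_add' := by
        intro x y; ext i; fin_cases i <;> simp; ring
      map_smul' := by
        intro c x; ext i; fin_cases i <;> simp }

theorem perp_apply (v : Plane) : perp v = !₂[-v 1, v 0] := rfl

theorem norm_perp (v : Plane) : ‖perp v‖ = ‖v‖ := by
  rw [perp_apply, EuclideanSpace.norm_eq, EuclideanSpace.norm_eq]
  simp [Fin.sum_univ_two, add_comm]

theorem inner_perp_self (v : Plane) : inner ℝ v (perp v) = 0 := by
  simp [perp_apply, PiLp.inner_apply, Fin.sum_univ_two]; ring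

theorem biotSavartKernel_eq (z : Plane) : biotSavartKernel z = perp (gradKernel z) := by
  rw [gradKernel, map_smul, perp_apply, biotSavartKernel]

theorem norm_gradKernel (z : Plane) : ‖gradKernel z‖ = (2 * Real.pi)⁻¹ * ‖z‖⁻¹ := by
  have : 0 < Real.pi := Real.pi_pos
  rw [gradKernel, norm_smul, Real.norm_of_nonneg (by positivity)]
  rcases eq_or_ne ‖z‖ 0 with h | h
  · simp [h]
  · field_simp

theorem norm_gradKernel_le (z : Plane) : ‖gradKernel z‖ ≤ ‖z‖⁻¹ := by
  rw [norm_gradKernel]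
  have h1 : (2 * Real.pi)⁻¹ ≤ 1 := by
    apply inv_le_one_of_one_le₀; linarith [Real.pi_gt_three]
  have : 0 ≤ ‖z‖⁻¹ := by positivity
  nlinarith

theorem measurable_gradKernel : Measurable gradKernel := by
  unfold gradKernel; fun_prop

theorem measurable_logKernel : Measurable logKernel := by
  unfold logKernel; fun_prop

theorem finrank_plane : Module.finrank ℝ Plane = 2 := by simp

theorem locallyIntegrable_inv_norm : LocallyIntegrable (fun z : Plane => ‖z‖⁻¹) := by
  refine locallyIntegrable_of_norm_le_rpow (C := 1) (α := 1) (by simp) (by simp) ?_ ?_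
  · refine Eventually.of_forall fun x => ?_
    rw [norm_inv, norm_norm, Real.rpow_neg_one, one_mul]
  · exact (by fun_prop : Measurable fun z : Plane => ‖z‖⁻¹).aestronglyMeasurable

theorem abs_log_le_add_inv {r : ℝ} (hr : 0 ≤ r) : |Real.log r| ≤ r + r⁻¹ := by
  have h0 : 0 ≤ r⁻¹ := inv_nonneg.2 hr
  have h1 := Real.log_le_self hr
  have h2 := Real.log_le_self h0
  rw [Real.log_inv] at h2
  rw [abs_le]
  constructor <;> linarith

theorem locallyIntegrable_log_norm : LocallyIntegrable (fun z : Plane => Real.log ‖z‖) := by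
  have h1 : LocallyIntegrable (fun z : Plane => ‖z‖) := continuous_norm.locallyIntegrable
  refine (h1.add locallyIntegrable_inv_norm).mono ?_ ?_
  · exact (by fun_prop : Measurable fun z : Plane => Real.log ‖z‖).aestronglyMeasurable
  · refine Eventually.of_forall fun x => ?_
    rw [Real.norm_eq_abs, Pi.add_apply,
      Real.norm_of_nonneg (by positivity : 0 ≤ ‖x‖ + ‖x‖⁻¹)]
    exact abs_log_le_add_inv (norm_nonneg x)

theorem locallyIntegrable_logKernel : LocallyIntegrable logKernel := by
  exact locallyIntegrable_log_norm.smul (2 * Real.pi)⁻¹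

theorem locallyIntegrable_gradKernel : LocallyIntegrable gradKernel := by
  refine locallyIntegrable_inv_norm.mono measurable_gradKernel.aestronglyMeasurable ?_
  refine Eventually.of_forall fun x => ?_
  rw [norm_inv, norm_norm]
  exact norm_gradKernel_le x

/-- Differences of points of the ball of radius R lie in the ball of radius 2R, so `k` may be
truncated there; what remains is the convolution integrand of two integrable functions. -/
theorem integrableOn_comp_sub {k : Plane → ℝ} (hk : LocallyIntegrable k) (R : ℝ) :
    IntegrableOn (fun p : Plane × Plane => k (p.1 - p.2))
      (Metric.closedBall 0 R ×ˢ Metric.closedBall 0 R) := by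
  have h1 : Integrable ((Metric.closedBall (0 : Plane) (2 * R)).indicator k) :=
    (integrable_indicator_iff Metric.isClosed_closedBall.measurableSet).2
      (hk.integrableOn_isCompact (isCompact_closedBall _ _))
  have h2 : Integrable ((Metric.closedBall (0 : Plane) R).indicator fun _ => (1 : ℝ)) :=
    (integrable_indicator_iff Metric.isClosed_closedBall.measurableSet).2
      (integrableOn_const (isCompact_closedBall (0 : Plane) R).measure_lt_top.ne)
  have h3 := (h2.convolution_integrand (ContinuousLinearMap.mul ℝ ℝ) h1).integrableOn
    (s := Metric.closedBall (0 : Plane) R ×ˢ Metric.closedBall (0 : Plane) R)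
  refine h3.congr_fun ?_
    (Metric.isClosed_closedBall.prod Metric.isClosed_closedBall).measurableSet
  intro p hp
  have hp1 := mem_closedBall_zero_iff.1 hp.1
  have hp2 := mem_closedBall_zero_iff.1 hp.2
  have : p.1 - p.2 ∈ Metric.closedBall (0 : Plane) (2 * R) :=
    mem_closedBall_zero_iff.2 ((norm_sub_le _ _).trans (by linarith))
  simp only [ContinuousLinearMap.mul_apply', indicator_of_mem hp.2, indicator_of_mem this, one_mul]

/-! ### Cartesian and polar coordinates. -/

/-- Cartesian coordinates on the plane. -/
def planeEquiv : Plane ≃ᵐ ℝ × ℝ :=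
  (MeasurableEquiv.toLp 2 (Fin 2 → ℝ)).symm.trans MeasurableEquiv.finTwoArrow

theorem planeEquiv_apply (x : Plane) : planeEquiv x = (x 0, x 1) := rfl

theorem planeEquiv_symm_apply (p : ℝ × ℝ) : planeEquiv.symm p = !₂[p.1, p.2] := by
  rw [MeasurableEquiv.symm_apply_eq, planeEquiv_apply]; simp

theorem measurePreserving_planeEquiv : MeasurePreserving planeEquiv :=
  (EuclideanSpace.volume_preserving_symm_measurableEquiv_toLp (Fin 2)).trans
    (volume_preserving_finTwoArrow ℝ)

/-- The unit vector at angle `θ`. -/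
def circleVec (θ : ℝ) : Plane := !₂[Real.cos θ, Real.sin θ]

theorem norm_circleVec (θ : ℝ) : ‖circleVec θ‖ = 1 := by
  simp [circleVec, EuclideanSpace.norm_eq]

theorem continuous_circleVec : Continuous circleVec := by
  unfold circleVec
  refine (PiLp.continuous_toLp 2 _).comp (continuous_pi fun i => ?_)
  fin_cases i
  · exact Real.continuous_cos
  · exact Real.continuous_sin

theorem hasDerivAt_circleVec (θ : ℝ) : HasDerivAt circleVec (perp (circleVec θ)) θ := by
  have h : HasDerivAt (fun θ => ![Real.cos θ, Real.sin θ]) ![-Real.sin θ, Real.cos θ] θ := by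
    rw [hasDerivAt_pi]
    intro i
    fin_cases i
    · exact Real.hasDerivAt_cos θ
    · exact Real.hasDerivAt_sin θ
  exact ((EuclideanSpace.equiv (Fin 2) ℝ).symm.hasFDerivAt.comp_hasDerivAt θ h)

theorem planeEquiv_symm_polarCoord_symm (p : ℝ × ℝ) :
    planeEquiv.symm (polarCoord.symm p) = p.1 • circleVec p.2 := by
  rw [planeEquiv_symm_apply, polarCoord_symm_apply, circleVec]
  ext i; fin_cases i <;> simp

theorem integral_plane_eq_polar {E : Type*} [NormedAddCommGroup E] [NormedSpace ℝ E]
    (f : Plane → E) :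
    ∫ x, f x = ∫ p in Ioi (0 : ℝ) ×ˢ Ioo (-Real.pi) Real.pi, p.1 • f (p.1 • circleVec p.2) := by
  rw [← measurePreserving_planeEquiv.symm.integral_comp planeEquiv.symm.measurableEmbedding,
    ← integral_comp_polarCoord_symm]
  simp_rw [planeEquiv_symm_polarCoord_symm]
  rfl

theorem integrableOn_polar {E : Type*} [NormedAddCommGroup E] [NormedSpace ℝ E]
    {f : Plane → E} (hf : Integrable f) :
    IntegrableOn (fun p : ℝ × ℝ => p.1 • f (p.1 • circleVec p.2))
      (Ioi (0 : ℝ) ×ˢ Ioo (-Real.pi) Real.pi) := by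
  have h1 : Integrable (f ∘ planeEquiv.symm) :=
    measurePreserving_planeEquiv.symm.integrable_comp_of_integrable hf
  have h2 := (integrableOn_image_iff_integrableOn_abs_det_fderiv_smul volume
    polarCoord.open_target.measurableSet
    (fun p _ => (hasFDerivAt_polarCoord_symm p).hasFDerivWithinAt)
    polarCoord.symm.injOn (f ∘ planeEquiv.symm)).1 h1.integrableOn
  refine h2.congr_fun ?_ polarCoord.open_target.measurableSet
  intro p hp
  have hp1 : 0 < p.1 := hp.1
  simp only [det_fderivPolarCoordSymm, abs_of_pos hp1, Function.comp_apply,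
    planeEquiv_symm_polarCoord_symm]

/-! ### Potential and velocity: uniform bounds and decay at infinity. -/

/-- The potential `Δ⁻¹ w`. -/
def potential (w : Plane → ℝ) (x : Plane) : ℝ := ∫ y, logKernel (x - y) * w y

/-- The gradient of the potential `Δ⁻¹ w`. -/
def gradPotential (w : Plane → ℝ) (x : Plane) : Plane := ∫ y, w y • gradKernel (x - y)

theorem biotSavart_eq (w : Plane → ℝ) (x : Plane) :
    biotSavart w x = perp (gradPotential w x) := by
  -- An antilipschitz map commutes with the Bochner integral even where the integrand is not
  -- integrable, so no hypothesis on `w` is needed.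
  have h : AntilipschitzWith 1 perp :=
    AddMonoidHomClass.antilipschitz_of_bound perp fun v => by simp [norm_perp]
  rw [gradPotential, ← ContinuousLinearMap.integral_comp_comm' perp h, biotSavart]
  simp_rw [map_smul, biotSavartKernel_eq]

theorem norm_biotSavart (w : Plane → ℝ) (x : Plane) : ‖biotSavart w x‖ = ‖gradPotential w x‖ := by
  rw [biotSavart_eq, norm_perp]

theorem integrable_indicator_inv_norm :
    Integrable ((Metric.closedBall (0 : Plane) 1).indicator fun z => ‖z‖⁻¹) :=
  (integrable_indicator_iff Metric.isClosed_closedBall.measurableSet).2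
    (locallyIntegrable_inv_norm.integrableOn_isCompact (isCompact_closedBall _ _))

theorem inv_norm_le_indicator_add_one (z : Plane) :
    ‖z‖⁻¹ ≤ (Metric.closedBall (0 : Plane) 1).indicator (fun z => ‖z‖⁻¹) z + 1 := by
  by_cases h : z ∈ Metric.closedBall (0 : Plane) 1
  · rw [indicator_of_mem h]; linarith
  · rw [indicator_of_notMem h, zero_add]
    rw [mem_closedBall_zero_iff, not_le] at h
    exact inv_le_one_of_one_le₀ h.le

/-- The kernel is split at distance 1: the singular part is integrable and meets the sup bound on
the vorticity, the rest is at most 1 and meets the L¹ bound. -/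
theorem exists_norm_gradPotential_le :
    ∃ C₀ : ℝ, 0 ≤ C₀ ∧ ∀ (w : Plane → ℝ) (C : ℝ), Integrable w → (∀ x, |w x| ≤ C) →
      ∫ x, |w x| ≤ C → ∀ x, ‖gradPotential w x‖ ≤ C₀ * C := by
  set h := (Metric.closedBall (0 : Plane) 1).indicator fun z => ‖z‖⁻¹ with hh
  have h0 : ∀ z, 0 ≤ h z := fun z => indicator_nonneg (fun z _ => by positivity) z
  have hi : Integrable h := integrable_indicator_inv_norm
  refine ⟨(∫ z, h z) + 1, add_nonneg (integral_nonneg h0) zero_le_one, ?_⟩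
  intro w C hw hb hC x
  have hC0 : 0 ≤ C := (abs_nonneg _).trans (hb 0)
  have hi' : Integrable fun y => h (x - y) := hi.comp_sub_left x
  have key : ‖gradPotential w x‖ ≤ ∫ y, (C * h (x - y) + |w y|) := by
    refine norm_integral_le_of_norm_le ((hi'.const_mul C).add hw.abs)
      (Eventually.of_forall fun y => ?_)
    rw [norm_smul, Real.norm_eq_abs]
    calc |w y| * ‖gradKernel (x - y)‖ ≤ |w y| * (h (x - y) + 1) := by
          gcongr
          exact (norm_gradKernel_le _).trans (inv_norm_le_indicator_add_one _)
      _ = |w y| * h (x - y) + |w y| := by ring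
      _ ≤ _ := by
          gcongr
          · exact h0 _
          · exact hb y
  rw [integral_add (hi'.const_mul C) hw.abs, integral_const_mul,
    integral_sub_left_eq_self h volume x] at key
  linarith

/-- Up to the factor (2π)⁻¹ the kernel is inversion in the unit circle, whose effect on distances is
an exact identity. -/
theorem norm_gradKernel_sub_le {a b : Plane} (ha : a ≠ 0) (hb : b ≠ 0) :
    ‖gradKernel a - gradKernel b‖ ≤ ‖a - b‖ / (‖a‖ * ‖b‖) := by
  have h := dist_div_norm_sq_smul ha hb 1
  have hpi : (2 * Real.pi)⁻¹ ≤ 1 := by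
    apply inv_le_one_of_one_le₀; linarith [Real.pi_gt_three]
  have hpi0 : 0 ≤ (2 * Real.pi)⁻¹ := by have := Real.pi_pos; positivity
  have e : gradKernel a - gradKernel b
      = (2 * Real.pi)⁻¹ • ((1 / ‖a‖) ^ 2 • a - (1 / ‖b‖) ^ 2 • b) := by
    simp only [gradKernel, smul_sub, smul_smul, one_div, inv_pow]
  rw [e, norm_smul, Real.norm_of_nonneg hpi0, ← dist_eq_norm, h, dist_eq_norm]
  calc _ ≤ 1 * (1 ^ 2 / (‖a‖ * ‖b‖) * ‖a - b‖) := by gcongr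
    _ = _ := by ring

theorem abs_log_sub_log_le {a b m : ℝ} (hm : 0 < m) (ha : m ≤ a) (hb : m ≤ b) :
    |Real.log a - Real.log b| ≤ |a - b| / m := by
  have key : ∀ a b : ℝ, m ≤ a → m ≤ b → Real.log a - Real.log b ≤ |a - b| / m := by
    intro a b ha hb
    have ha0 := hm.trans_le ha
    have hb0 := hm.trans_le hb
    rw [← Real.log_div ha0.ne' hb0.ne']
    have h1 := Real.log_le_sub_one_of_pos (div_pos ha0 hb0)
    have h2 : a / b - 1 = (a - b) / b := by field_simp
    rw [h2] at h1
    refine h1.trans ?_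
    calc (a - b) / b ≤ |a - b| / b := by gcongr; exact le_abs_self _
      _ ≤ |a - b| / m := by gcongr
  rw [abs_le]
  have h1 := key a b ha hb
  have h2 := key b a hb ha
  rw [abs_sub_comm] at h2
  constructor <;> linarith

theorem integrable_smul_gradKernel {w : Plane → ℝ} (hw : Continuous w) (hc : HasCompactSupport w)
    (x : Plane) : Integrable fun y => w y • gradKernel (x - y) := by
  have h1 : HasCompactSupport fun z => w (x - z) := hc.comp_homeomorph (Homeomorph.subLeft x)
  have h := (locallyIntegrable_gradKernel.integrable_smul_left_of_hasCompactSupport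
    (by fun_prop : Continuous fun z => w (x - z)) h1).comp_sub_left x
  simpa using h

theorem integrable_comp_sub_mul {k w : Plane → ℝ} (hk : LocallyIntegrable k) (hw : Continuous w)
    (hc : HasCompactSupport w) (x : Plane) : Integrable fun y => k (x - y) * w y := by
  have h1 : HasCompactSupport fun z => w (x - z) := hc.comp_homeomorph (Homeomorph.subLeft x)
  have h := (hk.integrable_smul_right_of_hasCompactSupport
    (by fun_prop : Continuous fun z => w (x - z)) h1).comp_sub_left x
  simpa using h

/-- Zero mean allows the kernel at x to be subtracted inside the integral, which gains one power of
|x|. Beyond twice the support radius, |x - y| ≥ |x|/2 on the support. -/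
theorem exists_decay {w : Plane → ℝ} (hw : Continuous w) (hc : HasCompactSupport w)
    (hm : ∫ x, w x = 0) :
    ∃ R C : ℝ, 0 < R ∧ 0 ≤ C ∧ ∀ x, R ≤ ‖x‖ →
      ‖gradPotential w x‖ ≤ C / ‖x‖ ^ 2 ∧ |potential w x| ≤ C / ‖x‖ := by
  obtain ⟨R, hR, hsupp⟩ := hc.isCompact.isBounded.exists_pos_norm_le
  have hwi : Integrable w := hw.integrable_of_hasCompactSupport hc
  have hz : ∀ y, R < ‖y‖ → w y = 0 := fun y hy =>
    image_eq_zero_of_notMem_tsupport fun h => absurd (hsupp y h) (not_le.2 hy)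
  have hpi : (2 * Real.pi)⁻¹ ≤ 1 := by
    apply inv_le_one_of_one_le₀; linarith [Real.pi_gt_three]
  have hpi0 : 0 ≤ (2 * Real.pi)⁻¹ := by have := Real.pi_pos; positivity
  refine ⟨2 * R, 2 * R * ∫ y, |w y|, by positivity,
    mul_nonneg (by positivity) (integral_nonneg fun _ => abs_nonneg _), fun x hx => ?_⟩
  have hx0 : 0 < ‖x‖ := by linarith
  have hxy : ∀ y, ‖y‖ ≤ R → ‖x‖ / 2 ≤ ‖x - y‖ := fun y hy => by
    have := norm_sub_norm_le x y; linarith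
  constructor
  · have e : gradPotential w x = ∫ y, w y • (gradKernel (x - y) - gradKernel x) := by
      simp_rw [smul_sub]
      rw [integral_sub (integrable_smul_gradKernel hw hc x) (hwi.smul_const _),
        integral_smul_const, hm, zero_smul, sub_zero, gradPotential]
    rw [e]
    have : 2 * R * (∫ y, |w y|) / ‖x‖ ^ 2 = ∫ y, 2 * R / ‖x‖ ^ 2 * |w y| := by
      rw [integral_const_mul]; ring
    rw [this]
    refine norm_integral_le_of_norm_le (hwi.abs.const_mul _) (Eventually.of_forall fun y => ?_)
    rw [norm_smul, Real.norm_eq_abs, mul_comm]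
    rcases le_or_gt ‖y‖ R with hy | hy
    · have h1 := hxy y hy
      have hxy0 : 0 < ‖x - y‖ := by linarith
      gcongr
      refine (norm_gradKernel_sub_le (norm_pos_iff.1 hxy0) (norm_pos_iff.1 hx0)).trans ?_
      have : ‖x - y - x‖ = ‖y‖ := by rw [sub_sub_cancel_left, norm_neg]
      rw [this]
      calc ‖y‖ / (‖x - y‖ * ‖x‖) ≤ R / (‖x‖ / 2 * ‖x‖) := by gcongr
        _ = 2 * R / ‖x‖ ^ 2 := by field_simp
    · simp [hz y hy]
  · have e : potential w x = ∫ y, (logKernel (x - y) - logKernel x) * w y := by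
      simp_rw [sub_mul]
      rw [integral_sub (integrable_comp_sub_mul locallyIntegrable_logKernel hw hc x) (hwi.const_mul _),
        integral_const_mul, hm, mul_zero, sub_zero, potential]
    rw [e, ← Real.norm_eq_abs]
    have : 2 * R * (∫ y, |w y|) / ‖x‖ = ∫ y, 2 * R / ‖x‖ * |w y| := by
      rw [integral_const_mul]; ring
    rw [this]
    refine norm_integral_le_of_norm_le (hwi.abs.const_mul _) (Eventually.of_forall fun y => ?_)
    rw [norm_mul, Real.norm_eq_abs, Real.norm_eq_abs]
    rcases le_or_gt ‖y‖ R with hy | hy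
    · have h1 := hxy y hy
      gcongr
      rw [logKernel, logKernel, ← mul_sub, abs_mul, abs_of_nonneg hpi0]
      have h2 := abs_log_sub_log_le (half_pos hx0) h1 (half_le_self hx0.le)
      have h3 : |‖x - y‖ - ‖x‖| ≤ R := by
        refine (abs_norm_sub_norm_le _ _).trans ?_
        rwa [sub_sub_cancel_left, norm_neg]
      calc _ ≤ 1 * (|‖x - y‖ - ‖x‖| / (‖x‖ / 2)) := by gcongr
        _ ≤ 1 * (R / (‖x‖ / 2)) := by gcongr
        _ = 2 * R / ‖x‖ := by field_simp
    · simp [hz y hy]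

/-! ### The weak gradient of the logarithm and the derivative of the potential. -/

/-- Monotonicity of log gives the lower bound, log p ≤ p - 1 the upper one. This dominates two
limits: the regularization of log |z|, and the thinning limit, where r is the second coordinate. -/
theorem abs_log_sq_add_sq_le {r s : ℝ} (hr : r ≠ 0) :
    |Real.log (r ^ 2 + s ^ 2)| ≤ 2 * |Real.log r| + (r ^ 2 + s ^ 2) := by
  have hr2 : 0 < r ^ 2 := by positivity
  have hp : 0 < r ^ 2 + s ^ 2 := by positivity
  have h1 : Real.log (r ^ 2) ≤ Real.log (r ^ 2 + s ^ 2) :=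
    Real.log_le_log hr2 (by linarith [sq_nonneg s])
  have h2 := Real.log_le_sub_one_of_pos hp
  rw [Real.log_pow] at h1
  push_cast at h1
  have h3 := neg_abs_le (Real.log r)
  have h4 := abs_nonneg (Real.log r)
  rw [abs_le]
  constructor <;> linarith

theorem hasFDerivAt_log_norm_sq_add {e : ℝ} (he : e ≠ 0) (z : Plane) :
    HasFDerivAt (fun z : Plane => Real.log (‖z‖ ^ 2 + e ^ 2))
      ((‖z‖ ^ 2 + e ^ 2)⁻¹ • ((2 : ℝ) • innerSL ℝ z)) z := by
  have h1 : HasFDerivAt (fun z : Plane => ‖z‖ ^ 2 + e ^ 2) ((2 : ℝ) • innerSL ℝ z) z := by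
    have := (hasStrictFDerivAt_norm_sq z).hasFDerivAt.add_const (e ^ 2)
    rwa [← Nat.cast_smul_eq_nsmul ℝ, Nat.cast_ofNat] at this
  exact h1.log (by positivity)

theorem continuous_fderiv_apply_const {E : Type*} [NormedAddCommGroup E] [NormedSpace ℝ E]
    {g : E → ℝ} (hg : ContDiff ℝ 1 g) (v : E) : Continuous fun z => fderiv ℝ g z v :=
  (hg.continuous_fderiv one_ne_zero).clm_apply continuous_const

/-- Integration by parts against the regularized logarithm. -/
theorem integral_log_norm_sq_add_mul_fderiv {g : Plane → ℝ} (hg : ContDiff ℝ 1 g)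
    (hc : HasCompactSupport g) (v : Plane) {e : ℝ} (he : e ≠ 0) :
    ∫ z, Real.log (‖z‖ ^ 2 + e ^ 2) * fderiv ℝ g z v
      = -∫ z, ((‖z‖ ^ 2 + e ^ 2)⁻¹ * (2 * inner ℝ z v)) * g z := by
  have hd := hasFDerivAt_log_norm_sq_add he
  have hpos : ∀ z : Plane, ‖z‖ ^ 2 + e ^ 2 ≠ 0 := fun z => by positivity
  have hlog : Continuous fun z : Plane => Real.log (‖z‖ ^ 2 + e ^ 2) :=
    Continuous.log (by fun_prop) hpos
  have hder : ∀ z, fderiv ℝ (fun z : Plane => Real.log (‖z‖ ^ 2 + e ^ 2)) z v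
      = (‖z‖ ^ 2 + e ^ 2)⁻¹ * (2 * inner ℝ z v) := fun z => by
    rw [(hd z).fderiv]; simp
  have hder_cont : Continuous fun z : Plane => (‖z‖ ^ 2 + e ^ 2)⁻¹ * (2 * inner ℝ z v) :=
    (Continuous.inv₀ (by fun_prop) hpos).mul (by fun_prop)
  rw [integral_mul_fderiv_eq_neg_fderiv_mul_of_integrable]
  · simp_rw [hder]
  · simp_rw [hder]
    exact (hder_cont.mul hg.continuous).integrable_of_hasCompactSupport hc.mul_left
  · exact (hlog.mul (continuous_fderiv_apply_const hg v)).integrable_of_hasCompactSupport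
      ((hc.fderiv_apply ℝ v).mul_left)
  · exact (hlog.mul hg.continuous).integrable_of_hasCompactSupport hc.mul_left
  · exact fun z _ => (hd z).differentiableAt
  · exact fun z _ => (hg.differentiable one_ne_zero) z

theorem ae_ne_plane (a : Plane) : ∀ᵐ z : Plane, z ≠ a :=
  compl_mem_ae_iff.2 (measure_singleton a)

/-- Integration by parts holds for the smooth log (|z|² + e²); then e → 0⁺ under domination by a
multiple of |log |z|| plus a polynomial on one side and of |z|⁻¹ on the other, both locally
integrable. -/
theorem integral_logKernel_mul_fderiv {g : Plane → ℝ} (hg : ContDiff ℝ 1 g)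
    (hc : HasCompactSupport g) (v : Plane) :
    ∫ z, logKernel z * fderiv ℝ g z v = -∫ z, inner ℝ (gradKernel z) v * g z := by
  have hgv := continuous_fderiv_apply_const hg v
  have hgc := hc.fderiv_apply ℝ v
  have hsmall : ∀ᶠ e : ℝ in 𝓝[>] 0, |e| ≤ 1 := by
    filter_upwards [Ioc_mem_nhdsGT (zero_lt_one' ℝ)] with e he
    rw [abs_of_pos he.1]; exact he.2
  have hpos : ∀ᶠ e : ℝ in 𝓝[>] 0, e ≠ 0 := by
    filter_upwards [self_mem_nhdsWithin] with e he using ne_of_gt he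
  have ht0 : Tendsto (fun e : ℝ => e) (𝓝[>] 0) (𝓝 0) := nhdsWithin_le_nhds
  have htz : ∀ z : Plane, Tendsto (fun e : ℝ => ‖z‖ ^ 2 + e ^ 2) (𝓝[>] 0) (𝓝 (‖z‖ ^ 2)) := by
    intro z
    simpa using (ht0.pow 2).const_add (‖z‖ ^ 2)
  have h1 : Tendsto (fun e : ℝ => ∫ z, Real.log (‖z‖ ^ 2 + e ^ 2) * fderiv ℝ g z v) (𝓝[>] 0)
      (𝓝 (∫ z, Real.log (‖z‖ ^ 2) * fderiv ℝ g z v)) := by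
    refine tendsto_integral_filter_of_dominated_convergence
      (fun z => ‖(2 * |Real.log ‖z‖| + (‖z‖ ^ 2 + 1)) * fderiv ℝ g z v‖) ?_ ?_ ?_ ?_
    · refine Eventually.of_forall fun e => Measurable.aestronglyMeasurable ?_
      exact (by fun_prop : Measurable fun z : Plane => Real.log (‖z‖ ^ 2 + e ^ 2)).mul
        hgv.measurable
    · filter_upwards [hsmall] with e he
      filter_upwards [ae_ne_plane 0] with z hz
      rw [norm_mul, norm_mul, Real.norm_eq_abs,
        Real.norm_of_nonneg (by positivity : 0 ≤ 2 * |Real.log ‖z‖| + (‖z‖ ^ 2 + 1))]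
      gcongr
      have he2 : e ^ 2 ≤ 1 := by rw [← sq_abs]; exact pow_le_one₀ (abs_nonneg _) he
      exact (abs_log_sq_add_sq_le (norm_pos_iff.2 hz).ne').trans (by linarith)
    · refine Integrable.norm ?_
      have habs : LocallyIntegrable fun z : Plane => |Real.log ‖z‖| :=
        locallyIntegrable_log_norm.mono
          (by fun_prop : Measurable fun z : Plane => |Real.log ‖z‖|).aestronglyMeasurable
          (Eventually.of_forall fun z => by simp)
      have : LocallyIntegrable fun z : Plane => 2 * |Real.log ‖z‖| + (‖z‖ ^ 2 + 1) :=
        (habs.smul (2 : ℝ)).add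
          (by fun_prop : Continuous fun z : Plane => ‖z‖ ^ 2 + 1).locallyIntegrable
      exact this.integrable_smul_right_of_hasCompactSupport hgv hgc
    · filter_upwards [ae_ne_plane 0] with z hz
      exact ((htz z).log (by positivity)).mul_const _
  have h2 : Tendsto (fun e : ℝ => ∫ z, ((‖z‖ ^ 2 + e ^ 2)⁻¹ * (2 * inner ℝ z v)) * g z) (𝓝[>] 0)
      (𝓝 (∫ z, ((‖z‖ ^ 2)⁻¹ * (2 * inner ℝ z v)) * g z)) := by
    refine tendsto_integral_filter_of_dominated_convergence
      (fun z => ‖(‖z‖⁻¹ * (2 * ‖v‖)) * g z‖) ?_ ?_ ?_ ?_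
    · refine Eventually.of_forall fun e => Measurable.aestronglyMeasurable ?_
      exact (by fun_prop : Measurable fun z : Plane =>
        (‖z‖ ^ 2 + e ^ 2)⁻¹ * (2 * inner ℝ z v)).mul hg.continuous.measurable
    · refine Eventually.of_forall fun e => ?_
      filter_upwards [ae_ne_plane 0] with z hz
      have hz0 : 0 < ‖z‖ := norm_pos_iff.2 hz
      rw [norm_mul, norm_mul _ (g z), norm_mul, norm_mul, norm_mul ‖z‖⁻¹, norm_mul 2 ‖v‖,
        norm_norm, norm_inv, norm_inv, norm_norm,
        Real.norm_of_nonneg (by positivity : 0 ≤ ‖z‖ ^ 2 + e ^ 2)]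
      gcongr ?_ * _
      calc (‖z‖ ^ 2 + e ^ 2)⁻¹ * (‖(2 : ℝ)‖ * ‖(inner ℝ z v : ℝ)‖)
          ≤ (‖z‖ ^ 2)⁻¹ * (‖(2 : ℝ)‖ * (‖z‖ * ‖v‖)) := by
            gcongr
            · linarith [sq_nonneg e]
            · exact norm_inner_le_norm z v
        _ = ‖z‖⁻¹ * (‖(2 : ℝ)‖ * ‖v‖) := by field_simp
    · refine Integrable.norm ?_
      have : LocallyIntegrable fun z : Plane => ‖z‖⁻¹ * (2 * ‖v‖) := by
        have h := locallyIntegrable_inv_norm.smul (2 * ‖v‖)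
        simp_rw [mul_comm _ (2 * ‖v‖)]
        exact h
      exact this.integrable_smul_right_of_hasCompactSupport hg.continuous hc
    · filter_upwards [ae_ne_plane 0] with z hz
      exact (((htz z).inv₀ (by positivity)).mul_const _).mul_const _
  have h3 : ∫ z, Real.log (‖z‖ ^ 2) * fderiv ℝ g z v
      = -∫ z, ((‖z‖ ^ 2)⁻¹ * (2 * inner ℝ z v)) * g z := by
    refine tendsto_nhds_unique (h1.congr' ?_) h2.neg
    filter_upwards [hpos] with e he using integral_log_norm_sq_add_mul_fderiv hg hc v he
  have e1 : ∀ z : Plane, logKernel z * fderiv ℝ g z v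
      = (4 * Real.pi)⁻¹ * (Real.log (‖z‖ ^ 2) * fderiv ℝ g z v) := fun z => by
    rw [logKernel, Real.log_pow]; push_cast; field_simp; ring
  have e2 : ∀ z : Plane, inner ℝ (gradKernel z) v * g z
      = (4 * Real.pi)⁻¹ * (((‖z‖ ^ 2)⁻¹ * (2 * inner ℝ z v)) * g z) := fun z => by
    rw [gradKernel, real_inner_smul_left]; field_simp; ring
  simp_rw [e1, e2, integral_const_mul]
  rw [h3, mul_neg]

theorem potential_eq_convolution (w : Plane → ℝ) :
    potential w = MeasureTheory.convolution logKernel w (ContinuousLinearMap.mul ℝ ℝ) volume := by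
  ext x
  rw [convolution_def, potential,
    ← integral_sub_left_eq_self (fun y => logKernel (x - y) * w y) volume x]
  simp

theorem inner_gradPotential {w : Plane → ℝ} (hw : Continuous w) (hc : HasCompactSupport w)
    (x v : Plane) :
    inner ℝ (gradPotential w x) v = ∫ y, w y * inner ℝ (gradKernel (x - y)) v := by
  rw [gradPotential, real_inner_comm, ← integral_inner (integrable_smul_gradKernel hw hc x)]
  simp_rw [real_inner_smul_right, real_inner_comm]

/-- Differentiating the convolution puts the derivative on `w`; the weak gradient formula, applied
to z ↦ w (x - z), moves it back to the kernel. -/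
theorem hasFDerivAt_potential {w : Plane → ℝ} (hw : ContDiff ℝ 1 w) (hc : HasCompactSupport w)
    (x : Plane) : HasFDerivAt (potential w) (innerSL ℝ (gradPotential w x)) x := by
  have h := hc.hasFDerivAt_convolution_right (ContinuousLinearMap.mul ℝ ℝ)
    locallyIntegrable_logKernel hw x
  rw [← potential_eq_convolution] at h
  suffices e : innerSL ℝ (gradPotential w x) = MeasureTheory.convolution logKernel (fderiv ℝ w)
      (ContinuousLinearMap.precompR Plane (ContinuousLinearMap.mul ℝ ℝ)) volume x by rwa [e]
  refine ContinuousLinearMap.ext fun v => ?_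
  rw [innerSL_apply_apply, inner_gradPotential hw.continuous hc]
  have hcx : HasCompactSupport fun z => w (x - z) := hc.comp_homeomorph (Homeomorph.subLeft x)
  have h1 := integral_logKernel_mul_fderiv (g := fun z => w (x - z))
    (hw.comp (contDiff_const.sub contDiff_id) ) hcx v
  have h2 : ∀ z, fderiv ℝ (fun z => w (x - z)) z v = -fderiv ℝ w (x - z) v := fun z => by
    have := ((hw.differentiable one_ne_zero (x - z)).hasFDerivAt.comp z
      ((hasFDerivAt_id z).const_sub x)).fderiv
    simp only [Function.comp_def] at this
    simp [this]
  simp_rw [h2, mul_neg, integral_neg, neg_inj] at h1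
  rw [convolution_precompR_apply _ locallyIntegrable_logKernel (hc.fderiv ℝ)
    (hw.continuous_fderiv one_ne_zero), convolution_def]
  simp only [ContinuousLinearMap.mul_apply']
  rw [h1, ← integral_sub_left_eq_self _ volume x]
  simp [mul_comm]

theorem contDiff_potential {w : Plane → ℝ} (hw : ContDiff ℝ 1 w) (hc : HasCompactSupport w) :
    ContDiff ℝ 1 (potential w) := by
  rw [potential_eq_convolution]
  exact hc.contDiff_convolution_right (n := 1) _ locallyIntegrable_logKernel hw

/-- Through the Riesz isometry this is the derivative of a C¹ function. -/
theorem continuous_gradPotential {w : Plane → ℝ} (hw : ContDiff ℝ 1 w)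
    (hc : HasCompactSupport w) : Continuous (gradPotential w) := by
  have h := (contDiff_potential hw hc).continuous_fderiv one_ne_zero
  have e : gradPotential w
      = fun x => (InnerProductSpace.toDual ℝ Plane).symm (fderiv ℝ (potential w) x) := by
    ext1 x
    rw [(hasFDerivAt_potential hw hc x).fderiv]
    exact ((InnerProductSpace.toDual ℝ Plane).symm_apply_apply _).symm
  rw [e]
  exact (InnerProductSpace.toDual ℝ Plane).symm.continuous.comp h

/-! ### Square integrability of the velocity. -/

theorem integrable_inv_one_add_norm_pow {n : ℕ} (hn : 2 < n) :
    Integrable fun x : Plane => ((1 + ‖x‖) ^ n)⁻¹ := by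
  have h := integrable_one_add_norm (E := Plane) (μ := volume) (r := (n : ℝ))
    (by rw [finrank_plane]; exact_mod_cast hn)
  simpa [Real.rpow_neg, add_nonneg] using h.congr (Eventually.of_forall fun x => by
    change (1 + ‖x‖) ^ (-(n : ℝ)) = ((1 + ‖x‖) ^ n)⁻¹
    rw [Real.rpow_neg (by positivity), Real.rpow_natCast])

theorem exists_norm_gradPotential_le_inv_sq {w : Plane → ℝ} (hw : ContDiff ℝ 1 w)
    (hc : HasCompactSupport w) (hm : ∫ x, w x = 0) :
    ∃ C, 0 ≤ C ∧ ∀ x, ‖gradPotential w x‖ ≤ C * ((1 + ‖x‖) ^ 2)⁻¹ := by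
  obtain ⟨R, C, hR, hC, h⟩ := exists_decay hw.continuous hc hm
  obtain ⟨B, hB⟩ := (isCompact_closedBall (0 : Plane) R).exists_bound_of_continuousOn
    (continuous_gradPotential hw hc).continuousOn
  -- The first summand serves |x| ≥ R, where 1 + |x| ≤ (1/R + 1)|x|; the second serves the ball,
  -- where continuity gives a bound.
  refine ⟨C * (1 / R + 1) ^ 2 + |B| * (1 + R) ^ 2, by positivity, fun x => ?_⟩
  rw [← div_eq_mul_inv, le_div_iff₀ (by positivity)]
  rcases le_or_gt R ‖x‖ with hx | hx
  · have hx0 : 0 < ‖x‖ := hR.trans_le hx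
    have h1 : 1 + ‖x‖ ≤ (1 / R + 1) * ‖x‖ := by
      have : 1 ≤ 1 / R * ‖x‖ := by rw [one_div, ← div_eq_inv_mul, le_div_iff₀ hR]; linarith
      linarith
    calc _ ≤ C / ‖x‖ ^ 2 * ((1 / R + 1) * ‖x‖) ^ 2 := by
          gcongr
          exact (h x hx).1
      _ = C * (1 / R + 1) ^ 2 := by field_simp
      _ ≤ _ := le_add_of_nonneg_right (by positivity)
  · calc _ ≤ |B| * (1 + R) ^ 2 := by
          gcongr
          exact (hB x (mem_closedBall_zero_iff.2 hx.le)).trans (le_abs_self B)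
      _ ≤ _ := le_add_of_nonneg_left (by positivity)

theorem memLp_gradPotential {w : Plane → ℝ} (hw : ContDiff ℝ 1 w)
    (hc : HasCompactSupport w) (hm : ∫ x, w x = 0) : MemLp (gradPotential w) 2 := by
  have hcont := continuous_gradPotential hw hc
  obtain ⟨C, hC, h⟩ := exists_norm_gradPotential_le_inv_sq hw hc hm
  rw [memLp_two_iff_integrable_sq_norm hcont.aestronglyMeasurable]
  refine ((integrable_inv_one_add_norm_pow (n := 4) (by norm_num)).const_mul (C ^ 2)).mono'
    (by fun_prop) (Eventually.of_forall fun x => ?_)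
  rw [Real.norm_of_nonneg (by positivity)]
  calc _ ≤ (C * ((1 + ‖x‖) ^ 2)⁻¹) ^ 2 := by gcongr; exact h x
    _ = _ := by rw [mul_pow, inv_pow, ← pow_mul]

theorem memLp_biotSavart {w : Plane → ℝ} (hw : ContDiff ℝ 1 w)
    (hc : HasCompactSupport w) (hm : ∫ x, w x = 0) : MemLp (biotSavart w) 2 := by
  have e : biotSavart w = fun x => perp (gradPotential w x) := funext (biotSavart_eq w)
  rw [e]
  exact perp.comp_memLp' (memLp_gradPotential hw hc hm)

/-! ### The energy as a quadratic form in the vorticity. -/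

theorem tendsto_potential_cocompact {w : Plane → ℝ} (hw : Continuous w)
    (hc : HasCompactSupport w) (hm : ∫ x, w x = 0) :
    Tendsto (potential w) (cocompact Plane) (𝓝 0) := by
  obtain ⟨R, C, hR, hC, h⟩ := exists_decay hw hc hm
  have hn := tendsto_norm_cocompact_atTop (E := Plane)
  refine squeeze_zero_norm' ?_ ((tendsto_const_nhds (x := C)).div_atTop hn)
  filter_upwards [hn.eventually_ge_atTop R] with x hx using (h x hx).2

/-- In polar coordinates about y the Jacobian cancels the singularity, and the integrand becomes
(2π)⁻¹ times the derivative of ψ along a ray. Each ray contributes -(2π)⁻¹ ψ(y), since ψ vanishes at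
infinity. This replaces Green's identity and needs no second derivatives. -/
theorem integral_inner_gradKernel {ψ : Plane → ℝ} {V : Plane → Plane}
    (hψ : ∀ x, HasFDerivAt ψ (innerSL ℝ (V x)) x) (h0 : Tendsto ψ (cocompact Plane) (𝓝 0))
    (y : Plane) (hi : Integrable fun x => inner ℝ (V x) (gradKernel (x - y))) :
    ∫ x, inner ℝ (V x) (gradKernel (x - y)) = -ψ y := by
  have hpi := Real.pi_pos
  have hi' : Integrable fun z => inner ℝ (V (z + y)) (gradKernel z) := by
    simpa using hi.comp_add_right y
  have hpol := integrableOn_polar hi'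
  have hset : MeasurableSet (Ioi (0 : ℝ) ×ˢ Ioo (-Real.pi) Real.pi) :=
    measurableSet_Ioi.prod measurableSet_Ioo
  have e : EqOn (fun p : ℝ × ℝ => p.1 • inner ℝ (V (p.1 • circleVec p.2 + y))
      (gradKernel (p.1 • circleVec p.2)))
      (fun p => (2 * Real.pi)⁻¹ * inner ℝ (V (p.1 • circleVec p.2 + y)) (circleVec p.2))
      (Ioi (0 : ℝ) ×ˢ Ioo (-Real.pi) Real.pi) := by
    intro p hp
    have hp1 : 0 < p.1 := hp.1
    simp only [gradKernel, norm_smul, norm_circleVec, mul_one, Real.norm_eq_abs, sq_abs,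
      real_inner_smul_right, smul_eq_mul]
    field_simp
  have e2 : ∫ x, inner ℝ (V x) (gradKernel (x - y))
      = ∫ z, inner ℝ (V (z + y)) (gradKernel z) := by
    rw [← integral_add_right_eq_self _ y]
    simp
  have hpol2 := hpol.congr_fun e hset
  rw [e2, integral_plane_eq_polar, setIntegral_congr_fun hset e]
  rw [IntegrableOn, Measure.volume_eq_prod, ← Measure.prod_restrict] at hpol2
  rw [Measure.volume_eq_prod, ← Measure.prod_restrict, integral_prod_symm _ hpol2]
  have key : ∀ᵐ θ ∂(volume.restrict (Ioo (-Real.pi) Real.pi)),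
      ∫ r in Ioi (0 : ℝ), (2 * Real.pi)⁻¹ * inner ℝ (V (r • circleVec θ + y)) (circleVec θ)
        = -((2 * Real.pi)⁻¹ * ψ y) := by
    filter_upwards [hpol2.prod_left_ae] with θ hθ
    have hd : ∀ r ∈ Ici (0 : ℝ), HasDerivAt
        (fun r => (2 * Real.pi)⁻¹ * ψ (r • circleVec θ + y))
        ((2 * Real.pi)⁻¹ * inner ℝ (V (r • circleVec θ + y)) (circleVec θ)) r := by
      intro r _
      have h1 : HasDerivAt (fun r : ℝ => r • circleVec θ + y) (circleVec θ) r := by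
        simpa using ((hasDerivAt_id r).smul_const (circleVec θ)).add_const y
      exact ((hψ _).comp_hasDerivAt r h1).const_mul _
    have hlim : Tendsto (fun r : ℝ => (2 * Real.pi)⁻¹ * ψ (r • circleVec θ + y)) atTop (𝓝 0) := by
      rw [← mul_zero (2 * Real.pi)⁻¹]
      refine (h0.comp ?_).const_mul _
      refine tendsto_cocompact_of_tendsto_dist_comp_atTop y
        (tendsto_id.congr' ?_)
      filter_upwards [eventually_ge_atTop 0] with r hr
      simp [dist_eq_norm, norm_smul, norm_circleVec, abs_of_nonneg hr]
    rw [integral_Ioi_of_hasDerivAt_of_tendsto' hd hθ hlim]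
    simp
  rw [integral_congr_ae key]
  simp only [integral_const, MeasurableSet.univ, measureReal_restrict_apply, univ_inter,
    Real.volume_real_Ioo, smul_eq_mul]
  rw [max_eq_left (by linarith)]
  field_simp
  ring

theorem integrable_mul_indicator_inv_norm {w : Plane → ℝ} (hw : Integrable w) :
    Integrable fun p : Plane × Plane => w p.2 *
      (Metric.closedBall (0 : Plane) 1).indicator (fun z => ‖z‖⁻¹) (p.1 - p.2) :=
  hw.convolution_integrand (ContinuousLinearMap.mul ℝ ℝ) integrable_indicator_inv_norm

/-- Justifies Fubini in the energy identity: near the diagonal the singularity is integrable against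
`w`, and away from it the kernel supplies the third power of decay that the plane requires. -/
theorem integrable_mul_inner_gradKernel {w : Plane → ℝ} {V : Plane → Plane} (hw : Continuous w)
    (hc : HasCompactSupport w) (hV : Continuous V) {C : ℝ} (hC : 0 ≤ C)
    (hb : ∀ x, ‖V x‖ ≤ C * ((1 + ‖x‖) ^ 2)⁻¹) :
    Integrable fun p : Plane × Plane => w p.2 * inner ℝ (V p.1) (gradKernel (p.1 - p.2)) := by
  obtain ⟨R, hR, hsupp⟩ := hc.isCompact.isBounded.exists_pos_norm_le
  have hz : ∀ y, R < ‖y‖ → w y = 0 := fun y hy =>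
    image_eq_zero_of_notMem_tsupport fun h => absurd (hsupp y h) (not_le.2 hy)
  have hwi : Integrable w := hw.integrable_of_hasCompactSupport hc
  have hm : Measurable fun p : Plane × Plane =>
      w p.2 * inner ℝ (V p.1) (gradKernel (p.1 - p.2)) := by
    have h1 := hw.measurable
    have h2 := hV.measurable
    have h3 := measurable_gradKernel
    fun_prop
  set h := (Metric.closedBall (0 : Plane) 1).indicator fun z => ‖z‖⁻¹ with hh
  have h0 : ∀ z, 0 ≤ h z := fun z => indicator_nonneg (fun z _ => by positivity) z
  have i1 := (integrable_mul_indicator_inv_norm hwi.abs).const_mul C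
  have i2 := ((integrable_inv_one_add_norm_pow (n := 3) (by norm_num)).const_mul
    (C * (2 + R))).mul_prod hwi.abs
  refine (i1.add i2).mono' hm.aestronglyMeasurable (Eventually.of_forall fun p => ?_)
  obtain ⟨x, y⟩ := p
  simp only [Pi.add_apply, norm_mul, Real.norm_eq_abs]
  rcases le_or_gt ‖y‖ R with hy | hy
  swap
  · simp [hz y hy]
  -- When |x - y| > 1 and |y| ≤ R, 1 + |x| ≤ 1 + |x - y| + R ≤ (2 + R)|x - y|.
  have hker : ‖x - y‖⁻¹ ≤ h (x - y) + (2 + R) * (1 + ‖x‖)⁻¹ := by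
    by_cases hx : x - y ∈ Metric.closedBall (0 : Plane) 1
    · rw [hh, indicator_of_mem hx]
      exact le_add_of_nonneg_right (by positivity)
    · rw [hh, indicator_of_notMem hx, zero_add]
      rw [mem_closedBall_zero_iff, not_le] at hx
      have h1 : ‖x‖ ≤ ‖x - y‖ + ‖y‖ := norm_le_norm_sub_add x y
      rw [← div_eq_mul_inv, le_div_iff₀ (by positivity), inv_mul_le_iff₀ (by linarith)]
      nlinarith
  have hi : |inner ℝ (V x) (gradKernel (x - y))|
      ≤ C * ((1 + ‖x‖) ^ 2)⁻¹ * (h (x - y) + (2 + R) * (1 + ‖x‖)⁻¹) :=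
    (abs_real_inner_le_norm _ _).trans
      (mul_le_mul (hb x) ((norm_gradKernel_le _).trans hker) (norm_nonneg _) (by positivity))
  have hle : ((1 + ‖x‖) ^ 2)⁻¹ ≤ 1 :=
    inv_le_one_of_one_le₀ (one_le_pow₀ (le_add_of_nonneg_right (norm_nonneg x)))
  calc |w y| * |inner ℝ (V x) (gradKernel (x - y))|
      ≤ |w y| * (C * ((1 + ‖x‖) ^ 2)⁻¹ * (h (x - y) + (2 + R) * (1 + ‖x‖)⁻¹)) := by gcongr
    _ = |w y| * C * h (x - y) * ((1 + ‖x‖) ^ 2)⁻¹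
        + C * (2 + R) * ((1 + ‖x‖) ^ 3)⁻¹ * |w y| := by field_simp
    _ ≤ |w y| * C * h (x - y) * 1 + C * (2 + R) * ((1 + ‖x‖) ^ 3)⁻¹ * |w y| := by
        gcongr
        exact mul_nonneg (by positivity) (h0 _)
    _ = _ := by ring

/-- The kinetic energy in terms of vorticity and potential. -/
theorem integral_norm_sq_gradPotential {w : Plane → ℝ} (hw : ContDiff ℝ 1 w)
    (hc : HasCompactSupport w) (hm : ∫ x, w x = 0) :
    ∫ x, ‖gradPotential w x‖ ^ 2 = -∫ y, w y * potential w y := by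
  obtain ⟨C, hC, hb⟩ := exists_norm_gradPotential_le_inv_sq hw hc hm
  have hint := integrable_mul_inner_gradKernel hw.continuous hc (continuous_gradPotential hw hc)
    hC hb
  have e : ∀ x, ‖gradPotential w x‖ ^ 2
      = ∫ y, w y * inner ℝ (gradPotential w x) (gradKernel (x - y)) := fun x => by
    rw [← real_inner_self_eq_norm_sq, inner_gradPotential hw.continuous hc]
    simp_rw [real_inner_comm]
  simp_rw [e]
  rw [integral_integral_swap hint, ← integral_neg]
  refine integral_congr_ae ?_
  filter_upwards [hint.prod_left_ae] with y hy
  -- Fubini yields integrability of the slice only with the factor `w y`, which can be divided out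
  -- only where it is nonzero.
  rcases eq_or_ne (w y) 0 with h0 | h0
  · simp [h0]
  have hy' : Integrable fun x => inner ℝ (gradPotential w x) (gradKernel (x - y)) := by
    have := hy.const_mul (w y)⁻¹
    refine this.congr (Eventually.of_forall fun x => ?_)
    simp only
    field_simp
  rw [integral_const_mul, integral_inner_gradKernel (hasFDerivAt_potential hw hc)
    (tendsto_potential_cocompact hw.continuous hc hm) y hy', mul_neg]

theorem l2Norm_sq {u : Plane → Plane} (hu : MemLp u 2) : l2Norm u ^ 2 = ∫ x, ‖u x‖ ^ 2 := by
  have h0 : 0 ≤ ∫ x, ‖u x‖ ^ 2 := integral_nonneg fun x => by positivity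
  rw [l2Norm, hu.eLpNorm_eq_integral_rpow_norm (by norm_num) (by norm_num),
    ENNReal.toReal_ofReal (by positivity)]
  simp only [ENNReal.toReal_ofNat, Real.rpow_two]
  rw [← Real.rpow_natCast, ← Real.rpow_mul h0]
  norm_num

theorem l2Norm_biotSavart_sq {w : Plane → ℝ} (hw : ContDiff ℝ 1 w)
    (hc : HasCompactSupport w) (hm : ∫ x, w x = 0) :
    l2Norm (biotSavart w) ^ 2 = -∫ y, w y * potential w y := by
  rw [l2Norm_sq (memLp_biotSavart hw hc hm), ← integral_norm_sq_gradPotential hw hc hm]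
  simp_rw [norm_biotSavart]

/-! ### The velocity is weakly divergence free. -/

/-- The rotated kernel is tangent to circles about y, so on each circle the integrand is a multiple
of the angular derivative of φ and integrates to zero by periodicity. -/
theorem integral_fderiv_perp_gradKernel {φ : Plane → ℝ} (hφ : ContDiff ℝ 1 φ)
    (hc : HasCompactSupport φ) (y : Plane) :
    ∫ x, fderiv ℝ φ x (perp (gradKernel (x - y))) = 0 := by
  have hDc := hφ.continuous_fderiv one_ne_zero
  have hi : Integrable fun z => fderiv ℝ φ (z + y) (perp (gradKernel z)) := by
    have hcy : HasCompactSupport fun z => fderiv ℝ φ (z + y) :=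
      (hc.fderiv ℝ).comp_homeomorph (Homeomorph.addRight y)
    have h1 := locallyIntegrable_inv_norm.integrable_smul_right_of_hasCompactSupport
      (by fun_prop : Continuous fun z => ‖fderiv ℝ φ (z + y)‖) hcy.norm
    refine h1.mono' (Measurable.aestronglyMeasurable ?_) (Eventually.of_forall fun z => ?_)
    · have h3 : Continuous fun p : Plane × Plane => fderiv ℝ φ (p.1 + y) (perp p.2) := by
        fun_prop
      exact h3.measurable.comp (measurable_id.prodMk measurable_gradKernel)
    · calc _ ≤ ‖fderiv ℝ φ (z + y)‖ * ‖perp (gradKernel z)‖ := ContinuousLinearMap.le_opNorm _ _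
        _ ≤ ‖fderiv ℝ φ (z + y)‖ * ‖z‖⁻¹ := by
            rw [norm_perp]; gcongr; exact norm_gradKernel_le z
        _ = _ := by rw [smul_eq_mul, mul_comm]
  have hpol := integrableOn_polar hi
  have hset : MeasurableSet (Ioi (0 : ℝ) ×ˢ Ioo (-Real.pi) Real.pi) :=
    measurableSet_Ioi.prod measurableSet_Ioo
  have e2 : ∫ x, fderiv ℝ φ x (perp (gradKernel (x - y)))
      = ∫ z, fderiv ℝ φ (z + y) (perp (gradKernel z)) := by
    rw [← integral_add_right_eq_self _ y]
    simp
  rw [e2, integral_plane_eq_polar, Measure.volume_eq_prod, setIntegral_prod _ hpol]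
  refine setIntegral_eq_zero_of_forall_eq_zero fun r hr => ?_
  have hr : 0 < r := hr
  have e : ∀ θ, r • fderiv ℝ φ (r • circleVec θ + y) (perp (gradKernel (r • circleVec θ)))
      = (2 * Real.pi)⁻¹ * r⁻¹ * fderiv ℝ φ (r • circleVec θ + y) (r • perp (circleVec θ)) := by
    intro θ
    simp only [gradKernel, norm_smul, norm_circleVec, mul_one, Real.norm_eq_abs, sq_abs,
      map_smul, smul_eq_mul]
    field_simp
  simp only [e]
  rw [integral_const_mul, ← integral_Ioc_eq_integral_Ioo,
    ← intervalIntegral.integral_of_le (by linarith [Real.pi_pos])]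
  have hd : ∀ θ, HasDerivAt (fun θ => φ (r • circleVec θ + y))
      (fderiv ℝ φ (r • circleVec θ + y) (r • perp (circleVec θ))) θ := fun θ =>
    (hφ.differentiable one_ne_zero _).hasFDerivAt.comp_hasDerivAt θ
      (((hasDerivAt_circleVec θ).const_smul r).add_const y)
  rw [intervalIntegral.integral_eq_sub_of_hasDerivAt (fun θ _ => hd θ)]
  · simp [circleVec]
  · have := continuous_circleVec
    exact Continuous.intervalIntegrable (by fun_prop) _ _

/-- The Biot-Savart velocity is weakly divergence free. -/
theorem integral_fderiv_biotSavart {w φ : Plane → ℝ} (hw : Continuous w)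
    (hwc : HasCompactSupport w) (hφ : ContDiff ℝ 1 φ) (hc : HasCompactSupport φ) :
    ∫ x, fderiv ℝ φ x (biotSavart w x) = 0 := by
  have hDc := hφ.continuous_fderiv one_ne_zero
  have hDi : Integrable fun x => ‖fderiv ℝ φ x‖ :=
    hDc.norm.integrable_of_hasCompactSupport (hc.fderiv ℝ).norm
  obtain ⟨C, hC⟩ := hDc.norm.bounded_above_of_compact_support (hc.fderiv ℝ).norm
  simp only [norm_norm] at hC
  have hwi : Integrable w := hw.integrable_of_hasCompactSupport hwc
  have e : ∀ x, fderiv ℝ φ x (biotSavart w x)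
      = ∫ y, w y * fderiv ℝ φ x (perp (gradKernel (x - y))) := fun x => by
    rw [biotSavart_eq, gradPotential, ← ContinuousLinearMap.comp_apply,
      ← ContinuousLinearMap.integral_comp_comm _ (integrable_smul_gradKernel hw hwc x)]
    simp
  have hint : Integrable fun p : Plane × Plane =>
      w p.2 * fderiv ℝ φ p.1 (perp (gradKernel (p.1 - p.2))) := by
    have i1 := (integrable_mul_indicator_inv_norm hwi.abs).const_mul C
    have i2 := hDi.mul_prod hwi.abs
    refine (i1.add i2).mono' (Measurable.aestronglyMeasurable ?_)
      (Eventually.of_forall fun p => ?_)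
    · refine (hw.measurable.comp measurable_snd).mul ?_
      have h3 : Continuous fun p : Plane × Plane => fderiv ℝ φ p.1 (perp p.2) := by
        fun_prop
      exact h3.measurable.comp
        (measurable_fst.prodMk (measurable_gradKernel.comp (by fun_prop)))
    · obtain ⟨x, y⟩ := p
      simp only [Pi.add_apply, norm_mul, Real.norm_eq_abs]
      set h := (Metric.closedBall (0 : Plane) 1).indicator fun z => ‖z‖⁻¹ with hh
      have h0 : ∀ z, 0 ≤ h z := fun z => indicator_nonneg (fun z _ => by positivity) z
      have h1 : |fderiv ℝ φ x (perp (gradKernel (x - y)))| ≤ ‖fderiv ℝ φ x‖ * (h (x - y) + 1) := by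
        rw [← Real.norm_eq_abs]
        refine (ContinuousLinearMap.le_opNorm _ _).trans ?_
        rw [norm_perp]
        gcongr
        exact (norm_gradKernel_le _).trans (inv_norm_le_indicator_add_one _)
      calc _ ≤ |w y| * (‖fderiv ℝ φ x‖ * (h (x - y) + 1)) := by gcongr
        _ = ‖fderiv ℝ φ x‖ * (|w y| * h (x - y)) + ‖fderiv ℝ φ x‖ * |w y| := by ring
        _ ≤ _ := by
          gcongr
          · exact mul_nonneg (abs_nonneg _) (h0 _)
          · exact hC x
  simp_rw [e]
  rw [integral_integral_swap hint]
  simp_rw [integral_const_mul, integral_fderiv_perp_gradKernel hφ hc, mul_zero, integral_zero]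

/-! ### Finite propagation speed. -/

theorem hasFDerivAt_slice {w : ℝ → Plane → ℝ} {t : ℝ} (ht : 0 ≤ t) {x : Plane}
    {L : ℝ × Plane →L[ℝ] ℝ}
    (hL : HasFDerivWithinAt (fun p : ℝ × Plane => w p.1 p.2) L (Ici 0 ×ˢ univ) (t, x)) :
    HasFDerivAt (w t) (L.comp (ContinuousLinearMap.inr ℝ ℝ Plane)) x := by
  have h := hL.comp x (s := univ) (f := fun y : Plane => (t, y))
    (hasFDerivAt_prodMk_right t x).hasFDerivWithinAt (fun y _ => ⟨ht, mem_univ y⟩)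
  rwa [hasFDerivWithinAt_univ] at h

/-- Domain of dependence for a transport equation with speed at most `K`. -/
theorem nonpos_of_transport {w : ℝ → Plane → ℝ} {u : ℝ → Plane → Plane} {K t₁ : ℝ} {x₁ : Plane}
    (hw : ContDiffOn ℝ 1 (fun p : ℝ × Plane => w p.1 p.2) (Ici 0 ×ˢ univ))
    (ht₁ : 0 ≤ t₁) (hu : ∀ t ∈ Icc 0 t₁, ∀ x, ‖u t x‖ ≤ K)
    (htr : ∀ t, 0 ≤ t → ∀ x, HasDerivWithinAt (fun s => w s x)
      (-(fderiv ℝ (w t) x (u t x))) (Ici 0) t)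
    (h0 : ∀ x, ‖x - x₁‖ ≤ K * t₁ → w 0 x ≤ 0) : w t₁ x₁ ≤ 0 := by
  have hK : 0 ≤ K := (norm_nonneg _).trans (hu 0 ⟨le_rfl, ht₁⟩ 0)
  refine le_of_forall_pos_le_add fun δ hδ => ?_
  -- Subtracting εt makes the maximum principle strict; this ε costs at most δ at time t₁, and the 1
  -- keeps the denominator positive.
  set ε := δ / (t₁ + 1) with hε
  have hε0 : 0 < ε := by positivity
  have hεt : ε * t₁ ≤ δ := by
    rw [hε, div_mul_eq_mul_div, div_le_iff₀ (by positivity)]; nlinarith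
  -- The backward cone of speed K with vertex (t₁, x₁); its base at time 0 is the ball on which `h0`
  -- applies.
  set D : Set (ℝ × Plane) := {p | p.1 ∈ Icc 0 t₁ ∧ ‖p.2 - x₁‖ ≤ K * (t₁ - p.1)} with hD
  have hDS : D ⊆ Ici 0 ×ˢ univ := fun p hp => ⟨hp.1.1, mem_univ _⟩
  have hDc : IsCompact D := by
    refine ((isCompact_Icc (a := (0 : ℝ)) (b := t₁)).prod (isCompact_closedBall x₁ (K * t₁))).of_isClosed_subset ?_ ?_
    · refine (isClosed_Icc.preimage continuous_fst).inter ?_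
      exact isClosed_le (f := fun p : ℝ × Plane => ‖p.2 - x₁‖)
        (g := fun p : ℝ × Plane => K * (t₁ - p.1)) (by fun_prop) (by fun_prop)
    · intro p hp
      refine ⟨hp.1, mem_closedBall_iff_norm.2 (hp.2.trans ?_)⟩
      have := hp.1.1
      gcongr
      linarith
  have hv : ContinuousOn (fun p : ℝ × Plane => w p.1 p.2 - ε * p.1) D :=
    (hw.continuousOn.mono hDS).sub (by fun_prop)
  have hmem : (t₁, x₁) ∈ D := ⟨⟨ht₁, le_rfl⟩, by simp⟩
  obtain ⟨⟨t, x⟩, hp, hmax⟩ := hDc.exists_isMaxOn ⟨_, hmem⟩ hv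
  have hfin : w t x - ε * t ≤ 0 → w t₁ x₁ ≤ 0 + δ := fun h => by
    have := hmax hmem
    simp only [mem_ofPred_eq] at this
    linarith
  rcases hp.1.1.eq_or_lt with h | ht
  · simp only at h
    subst h
    refine hfin ?_
    have := h0 x (by simpa using hp.2)
    linarith
  exfalso
  simp only at ht
  set L := fderivWithin ℝ (fun p : ℝ × Plane => w p.1 p.2) (Ici 0 ×ˢ univ) (t, x) with hL
  have hLd : HasFDerivWithinAt (fun p : ℝ × Plane => w p.1 p.2) L (Ici 0 ×ˢ univ) (t, x) :=
    ((hw.differentiableOn one_ne_zero) (t, x) ⟨ht.le, mem_univ _⟩).hasFDerivWithinAt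
  set v := u t x with hvdef
  have hvK : ‖v‖ ≤ K := hu t hp.1 x
  have hslice := (hasFDerivAt_slice ht.le hLd).fderiv
  -- The transport equation: w has zero derivative in the space-time direction (1, v).
  have hLt : L (1, 0) = -(L (0, v)) := by
    have h1 : HasDerivWithinAt (fun s => w s x) (L (1, 0)) (Ici 0) t :=
      hLd.comp_hasDerivWithinAt (f := fun s : ℝ => (s, x)) t
        ((hasDerivAt_id t).prodMk (hasDerivAt_const t x)).hasDerivWithinAt
        (fun s (hs : s ∈ Ici (0 : ℝ)) => (⟨hs, mem_univ _⟩ : (s, x) ∈ Ici (0 : ℝ) ×ˢ univ))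
    have h2 := htr t ht.le x
    rw [(uniqueDiffOn_Ici (0 : ℝ) t ht.le).eq_deriv _ h1 h2, hslice]
    rfl
  -- Going back in time with velocity v stays in the cone because |v| ≤ K. Along this path w is
  -- stationary to first order while -εt increases at rate ε.
  have hpath : ∀ s ∈ Icc (0 : ℝ) t, (t - s, x - s • v) ∈ D := by
    intro s hs
    have hp2 : ‖x - x₁‖ ≤ K * (t₁ - t) := hp.2
    have hp1 : t ≤ t₁ := hp.1.2
    refine ⟨⟨by linarith [hs.2], by linarith [hs.1]⟩, ?_⟩
    calc ‖x - s • v - x₁‖ = ‖(x - x₁) - s • v‖ := by congr 1; abel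
      _ ≤ ‖x - x₁‖ + ‖s • v‖ := norm_sub_le _ _
      _ ≤ K * (t₁ - t) + s * K := by
          rw [norm_smul, Real.norm_of_nonneg hs.1]
          gcongr
          exact hs.1
      _ = K * (t₁ - (t - s)) := by ring
  have hderiv : HasDerivWithinAt (fun s => w (t - s) (x - s • v) - ε * (t - s)) ε
      (Icc 0 t) 0 := by
    have hc1 : HasDerivAt (fun s : ℝ => (t - s, x - s • v)) ((-1 : ℝ), -v) 0 := by
      refine HasDerivAt.prodMk ?_ ?_
      · simpa using (hasDerivAt_id (0 : ℝ)).const_sub t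
      · simpa using ((hasDerivAt_id (0 : ℝ)).smul_const v).const_sub x
    have hLd' : HasFDerivWithinAt (fun p : ℝ × Plane => w p.1 p.2) L (Ici 0 ×ˢ univ)
        ((fun s : ℝ => (t - s, x - s • v)) 0) := by simpa using hLd
    have h1 := hLd'.comp_hasDerivWithinAt (0 : ℝ) (s := Icc 0 t) hc1.hasDerivWithinAt
      (fun s hs => hDS (hpath s hs))
    have h2 : HasDerivWithinAt (fun s : ℝ => ε * (t - s)) (-ε) (Icc 0 t) 0 := by
      simpa using (((hasDerivAt_id (0 : ℝ)).const_sub t).const_mul ε).hasDerivWithinAt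
    refine (h1.sub h2).congr_deriv ?_
    have : ((-1 : ℝ), -v) = -((1 : ℝ), (0 : Plane)) - ((0 : ℝ), v) := by simp
    rw [this, map_sub, map_neg, hLt]
    ring
  have hmax0 : IsMaxOn (fun s => w (t - s) (x - s • v) - ε * (t - s)) (Icc 0 t) 0 := by
    intro s hs
    have := hmax (hpath s hs)
    simpa using this
  -- At a maximum at the initial end of a segment the one-sided derivative is nonpositive, which
  -- forces εt ≤ 0 although both factors are positive.
  have h1 := hmax0.localize.hasFDerivWithinAt_nonpos hderiv.hasFDerivWithinAt
    (y := t) (mem_posTangentConeAt_of_segment_subset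
      (by rw [zero_add, segment_eq_Icc ht.le]))
  simp at h1
  nlinarith

theorem contDiff_slice {w : ℝ → Plane → ℝ}
    (hw : ContDiffOn ℝ 1 (fun p : ℝ × Plane => w p.1 p.2) (Ici 0 ×ˢ univ)) {t : ℝ} (ht : 0 ≤ t) :
    ContDiff ℝ 1 (w t) := by
  rw [← contDiffOn_univ]
  exact hw.comp (f := fun x : Plane => (t, x)) (contDiff_prodMk_right t).contDiffOn
    fun x _ => ⟨ht, mem_univ x⟩

theorem continuousOn_fderiv_slice {w : ℝ → Plane → ℝ}
    (hw : ContDiffOn ℝ 1 (fun p : ℝ × Plane => w p.1 p.2) (Ici 0 ×ˢ univ)) :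
    ContinuousOn (fun p : ℝ × Plane => fderiv ℝ (w p.1) p.2) (Ici 0 ×ˢ univ) := by
  have hu : UniqueDiffOn ℝ (Ici (0 : ℝ) ×ˢ (univ : Set Plane)) :=
    (uniqueDiffOn_Ici 0).prod uniqueDiffOn_univ
  have h := (hw.continuousOn_fderivWithin hu le_rfl).clm_comp
    (continuousOn_const (c := ContinuousLinearMap.inr ℝ ℝ Plane))
  refine h.congr fun p hp => ?_
  exact (hasFDerivAt_slice hp.1
    ((hw.differentiableOn one_ne_zero) p hp).hasFDerivWithinAt).fderiv

theorem IsEulerSolution.exists_norm_biotSavart_le {w₀ : Plane → ℝ} {w : ℝ → Plane → ℝ}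
    (h : IsEulerSolution w₀ w) (T : ℝ) :
    ∃ K, ∀ t ∈ Icc 0 T, ∀ x, ‖biotSavart (w t) x‖ ≤ K := by
  obtain ⟨C₀, -, hC₀⟩ := exists_norm_gradPotential_le
  obtain ⟨C, hC⟩ := h.bounds T
  refine ⟨C₀ * C, fun t ht x => ?_⟩
  obtain ⟨h1, h2, h3⟩ := hC t ht
  rw [norm_biotSavart]
  exact hC₀ _ C h1 h3 h2 x

/-- The vorticity of a solution with compactly supported initial data stays compactly supported,
uniformly on bounded time intervals. -/
theorem IsEulerSolution.exists_support {w₀ : Plane → ℝ} {w : ℝ → Plane → ℝ}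
    (h : IsEulerSolution w₀ w) (hc : HasCompactSupport w₀) {T : ℝ} (hT : 0 ≤ T) :
    ∃ R, ∀ t ∈ Icc 0 T, ∀ x, R < ‖x‖ → w t x = 0 := by
  obtain ⟨K, hK⟩ := h.exists_norm_biotSavart_le T
  obtain ⟨R, hR, hsupp⟩ := hc.isCompact.isBounded.exists_pos_norm_le
  have hK0 : 0 ≤ K := (norm_nonneg _).trans (hK 0 ⟨le_rfl, hT⟩ 0)
  -- The support spreads at speed at most K; the one-sided principle is applied to w and to -w.
  refine ⟨R + K * T, fun t ht x hx => ?_⟩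
  have hz : ∀ y, ‖y - x‖ ≤ K * t → w 0 y = 0 := fun y hy => by
    rw [h.initial]
    refine image_eq_zero_of_notMem_tsupport fun hy' => ?_
    have h1 := hsupp y hy'
    have h2 : K * t ≤ K * T := by gcongr; exact ht.2
    have h3 := norm_sub_norm_le x y
    rw [norm_sub_rev] at h3
    linarith
  have hu : ∀ s ∈ Icc 0 t, ∀ x, ‖biotSavart (w s) x‖ ≤ K := fun s hs x =>
    hK s ⟨hs.1, hs.2.trans ht.2⟩ x
  refine le_antisymm ?_ ?_
  · exact nonpos_of_transport (u := fun t => biotSavart (w t)) h.contDiffOn ht.1 hu h.transport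
      fun y hy => (hz y hy).le
  · have := nonpos_of_transport (w := fun t x => -w t x) (u := fun t => biotSavart (w t))
      h.contDiffOn.neg ht.1 hu (fun t ht x => by
        have h1 := (h.transport t ht x).neg
        rw [fderiv_fun_neg]
        exact h1) (x₁ := x) fun y hy => by rw [hz y hy, neg_zero]
    linarith

/-! ### Conservation of mean and energy. -/

/-- The time derivative `-u · ∇w` of a transported vorticity. -/
def vorticityRate (w : Plane → ℝ) (x : Plane) : ℝ := -(fderiv ℝ w x (biotSavart w x))

theorem hasCompactSupport_of_norm_lt {w : Plane → ℝ} {R : ℝ} (h : ∀ x, R < ‖x‖ → w x = 0) :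
    HasCompactSupport w :=
  HasCompactSupport.intro (isCompact_closedBall 0 R) fun x hx =>
    h x (by simpa using hx)

theorem continuous_vorticityRate {w : Plane → ℝ} (hw : ContDiff ℝ 1 w)
    (hc : HasCompactSupport w) : Continuous (vorticityRate w) := by
  have h1 := hw.continuous_fderiv one_ne_zero
  have h2 : Continuous (biotSavart w) := by
    rw [funext (biotSavart_eq w)]
    exact perp.continuous.comp (continuous_gradPotential hw hc)
  unfold vorticityRate
  fun_prop

/-- Bounds on the vorticity and its rate, and a ball carrying both, uniform on [0, T]: these give
the dominating functions for differentiation under the integral. -/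
theorem IsEulerSolution.exists_bound {w₀ : Plane → ℝ} {w : ℝ → Plane → ℝ}
    (h : IsEulerSolution w₀ w) (hc : HasCompactSupport w₀) {T : ℝ} (hT : 0 ≤ T) :
    ∃ R B, 0 ≤ B ∧ ∀ t ∈ Icc 0 T, ∀ x, |w t x| ≤ B ∧ |vorticityRate (w t) x| ≤ B ∧
      (R < ‖x‖ → w t x = 0 ∧ vorticityRate (w t) x = 0) := by
  obtain ⟨K, hK⟩ := h.exists_norm_biotSavart_le T
  obtain ⟨R, hR⟩ := h.exists_support hc hT
  obtain ⟨C, hC⟩ := h.bounds T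
  have hsub : Icc 0 T ×ˢ Metric.closedBall (0 : Plane) R ⊆ Ici 0 ×ˢ univ :=
    prod_mono Icc_subset_Ici_self (subset_univ _)
  obtain ⟨B, hB⟩ := (isCompact_Icc.prod (isCompact_closedBall (0 : Plane) R)
    ).exists_bound_of_continuousOn ((continuousOn_fderiv_slice h.contDiffOn).mono hsub)
  have hK0 : 0 ≤ K := (norm_nonneg _).trans (hK 0 ⟨le_rfl, hT⟩ 0)
  have hzero : ∀ t ∈ Icc 0 T, ∀ x, R < ‖x‖ → vorticityRate (w t) x = 0 := by
    intro t ht x hx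
    have h1 : w t =ᶠ[𝓝 x] fun _ => 0 := by
      filter_upwards [(isOpen_lt continuous_const continuous_norm).mem_nhds hx] with y hy
      exact hR t ht y hy
    rw [vorticityRate, h1.fderiv_eq]
    simp
  refine ⟨R, max C (|B| * K), le_max_of_le_right (by positivity), fun t ht x => ⟨?_, ?_, ?_⟩⟩
  · exact ((hC t ht).2.2 x).trans (le_max_left _ _)
  · rcases le_or_gt ‖x‖ R with hx | hx
    · refine le_trans ?_ (le_max_right _ _)
      rw [vorticityRate, abs_neg, ← Real.norm_eq_abs]
      refine (ContinuousLinearMap.le_opNorm _ _).trans ?_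
      gcongr
      · exact (hB (t, x) ⟨ht, mem_closedBall_zero_iff.2 hx⟩).trans (le_abs_self B)
      · exact hK t ht x
    · rw [hzero t ht x hx, abs_zero]
      exact le_max_of_le_right (by positivity)
  · exact fun hx => ⟨hR t ht x hx, hzero t ht x hx⟩

/-- An integral whose integrand has a time derivative of zero mean is conserved. -/
theorem integral_eq_of_integral_deriv_eq_zero {α : Type*} [MeasurableSpace α] {μ : Measure α}
    {f f' : ℝ → α → ℝ} {T : ℝ} (hT : 0 ≤ T) {bound : α → ℝ} (hb : Integrable bound μ)
    (hm : ∀ t ∈ Icc 0 T, AEStronglyMeasurable (f t) μ)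
    (hm' : ∀ t ∈ Icc 0 T, AEStronglyMeasurable (f' t) μ)
    (hbd : ∀ t ∈ Icc 0 T, ∀ a, ‖f t a‖ ≤ bound a)
    (hbd' : ∀ t ∈ Icc 0 T, ∀ a, ‖f' t a‖ ≤ bound a)
    (hc : ∀ a, ContinuousOn (fun t => f t a) (Icc 0 T))
    (hd : ∀ t ∈ Ioo 0 T, ∀ a, HasDerivAt (fun t => f t a) (f' t a) t)
    (h0 : ∀ t ∈ Ioo 0 T, ∫ a, f' t a ∂μ = 0) :
    ∫ a, f T a ∂μ = ∫ a, f 0 a ∂μ := by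
  rcases hT.eq_or_lt with rfl | hT
  · rfl
  have hcont : ContinuousOn (fun t => ∫ a, f t a ∂μ) (Icc 0 T) :=
    continuousOn_of_dominated hm (fun t ht => Eventually.of_forall (hbd t ht)) hb
      (Eventually.of_forall hc)
  have hderiv : ∀ t ∈ Ioo 0 T, HasDerivAt (fun t => ∫ a, f t a ∂μ) 0 t := by
    intro t ht
    have hnhds : Ioo 0 T ∈ 𝓝 t := isOpen_Ioo.mem_nhds ht
    have h := hasDerivAt_integral_of_dominated_loc_of_deriv_le (F := f) (F' := f')
      (bound := bound) (μ := μ) hnhds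
      (by filter_upwards [hnhds] with s hs using hm s (Ioo_subset_Icc_self hs))
      (hb.mono' (hm t (Ioo_subset_Icc_self ht))
        (Eventually.of_forall (hbd t (Ioo_subset_Icc_self ht))))
      (hm' t (Ioo_subset_Icc_self ht))
      (Eventually.of_forall fun a s hs => hbd' s (Ioo_subset_Icc_self hs) a) hb
      (Eventually.of_forall fun a s hs => hd s hs a)
    rw [← h0 t ht]
    exact h.2
  -- Mean value theorem: the derivative is zero in the interior, and continuity covers the
  -- endpoints.
  obtain ⟨c, -, hc0⟩ := exists_hasDerivAt_eq_slope _ (fun _ => 0) hT hcont hderiv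
  rw [eq_comm, div_eq_zero_iff] at hc0
  rcases hc0 with hc0 | hc0 <;> linarith

theorem IsEulerSolution.continuousOn_time {w₀ : Plane → ℝ} {w : ℝ → Plane → ℝ}
    (h : IsEulerSolution w₀ w) (x : Plane) (T : ℝ) : ContinuousOn (fun t => w t x) (Icc 0 T) :=
  fun t ht => ((h.transport t ht.1 x).continuousWithinAt).mono Icc_subset_Ici_self

theorem IsEulerSolution.hasDerivAt_time {w₀ : Plane → ℝ} {w : ℝ → Plane → ℝ}
    (h : IsEulerSolution w₀ w) (x : Plane) {t : ℝ} (ht : 0 < t) :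
    HasDerivAt (fun t => w t x) (vorticityRate (w t) x) t :=
  (h.transport t ht.le x).hasDerivAt (Ici_mem_nhds ht)

theorem integral_vorticityRate {w : Plane → ℝ} (hw : ContDiff ℝ 1 w)
    (hc : HasCompactSupport w) : ∫ x, vorticityRate w x = 0 := by
  simp_rw [vorticityRate]
  rw [integral_neg, integral_fderiv_biotSavart hw.continuous hc hw hc, neg_zero]

/-- The weak divergence identity is tested with wψ. In ∇(wψ)·u the term w ∇ψ·u vanishes, since u is
the rotation of ∇ψ. -/
theorem integral_vorticityRate_mul_potential {w : Plane → ℝ} (hw : ContDiff ℝ 1 w)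
    (hc : HasCompactSupport w) : ∫ x, vorticityRate w x * potential w x = 0 := by
  have h := integral_fderiv_biotSavart hw.continuous hc (hw.mul (contDiff_potential hw hc))
    hc.mul_right
  have e : ∀ x, fderiv ℝ (w * potential w) x (biotSavart w x)
      = -(vorticityRate w x * potential w x) := fun x => by
    rw [((hw.differentiable one_ne_zero x).hasFDerivAt.mul (hasFDerivAt_potential hw hc x)).fderiv]
    simp [vorticityRate, biotSavart_eq, inner_perp_self, mul_comm]
  have h' : ∫ x, fderiv ℝ (w * potential w) x (biotSavart w x) = 0 := h
  simp_rw [e, integral_neg, neg_eq_zero] at h'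
  exact h'

/-- The mean of the vorticity is conserved. -/
theorem IsEulerSolution.integral_eq {w₀ : Plane → ℝ} {w : ℝ → Plane → ℝ}
    (h : IsEulerSolution w₀ w) (hc : HasCompactSupport w₀) {T : ℝ} (hT : 0 ≤ T) :
    ∫ x, w T x = ∫ x, w₀ x := by
  obtain ⟨R, B, hB, hbd⟩ := h.exists_bound hc hT
  have hw : ∀ t ∈ Icc 0 T, ContDiff ℝ 1 (w t) := fun t ht => contDiff_slice h.contDiffOn ht.1
  have hcs : ∀ t ∈ Icc 0 T, HasCompactSupport (w t) := fun t ht =>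
    hasCompactSupport_of_norm_lt fun x hx => ((hbd t ht x).2.2 hx).1
  rw [← h.initial]
  refine integral_eq_of_integral_deriv_eq_zero (f' := fun t => vorticityRate (w t))
    (bound := (Metric.closedBall (0 : Plane) R).indicator fun _ => B) hT ?_
    (fun t ht => (hw t ht).continuous.aestronglyMeasurable)
    (fun t ht => (continuous_vorticityRate (hw t ht) (hcs t ht)).aestronglyMeasurable)
    ?_ ?_ (fun x => h.continuousOn_time x T) (fun t ht x => h.hasDerivAt_time x ht.1)
    (fun t ht => integral_vorticityRate (hw t (Ioo_subset_Icc_self ht))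
      (hcs t (Ioo_subset_Icc_self ht)))
  · exact (integrable_indicator_iff Metric.isClosed_closedBall.measurableSet).2
      (integrableOn_const (isCompact_closedBall (0 : Plane) R).measure_lt_top.ne)
  · intro t ht x
    by_cases hx : x ∈ Metric.closedBall (0 : Plane) R
    · rw [indicator_of_mem hx]; exact (hbd t ht x).1
    · rw [indicator_of_notMem hx, ((hbd t ht x).2.2 (by simpa using hx)).1, norm_zero]
  · intro t ht x
    by_cases hx : x ∈ Metric.closedBall (0 : Plane) R
    · rw [indicator_of_mem hx]; exact (hbd t ht x).2.1
    · rw [indicator_of_notMem hx, ((hbd t ht x).2.2 (by simpa using hx)).2, norm_zero]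

theorem integrable_comp_sub_mul_mul {k f g : Plane → ℝ} (hk : LocallyIntegrable k)
    (hf : Continuous f) (hfc : HasCompactSupport f) (hg : Continuous g)
    (hgc : HasCompactSupport g) :
    Integrable fun p : Plane × Plane => k (p.1 - p.2) * f p.1 * g p.2 := by
  obtain ⟨R₁, h1, hs1⟩ := hfc.isCompact.isBounded.exists_pos_norm_le
  obtain ⟨R₂, h2, hs2⟩ := hgc.isCompact.isBounded.exists_pos_norm_le
  obtain ⟨C₁, hC₁⟩ := hf.bounded_above_of_compact_support hfc
  obtain ⟨C₂, hC₂⟩ := hg.bounded_above_of_compact_support hgc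
  set S := Metric.closedBall (0 : Plane) (max R₁ R₂) ×ˢ Metric.closedBall (0 : Plane) (max R₁ R₂)
  have h := integrableOn_comp_sub hk (max R₁ R₂)
  have hS : MeasurableSet S := (Metric.isClosed_closedBall.prod
    Metric.isClosed_closedBall).measurableSet
  have hfg : Continuous fun p : Plane × Plane => f p.1 * g p.2 := by fun_prop
  have h3 : IntegrableOn (fun p : Plane × Plane => (f p.1 * g p.2) * k (p.1 - p.2)) S := by
    refine Integrable.bdd_mul (c := C₁ * C₂) h hfg.aestronglyMeasurable.restrict
      (Eventually.of_forall fun p => ?_)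
    rw [norm_mul]
    have := (norm_nonneg _).trans (hC₁ 0)
    gcongr
    · exact hC₁ _
    · exact hC₂ _
  refine (integrableOn_iff_integrable_of_support_subset ?_).1
    (h3.congr_fun (fun p _ => by ring) hS)
  intro p hp
  rw [Function.mem_support] at hp
  refine ⟨mem_closedBall_zero_iff.2 ?_, mem_closedBall_zero_iff.2 ?_⟩
  · exact (hs1 _ (subset_tsupport _ fun h => hp (by simp [h]))).trans (le_max_left _ _)
  · exact (hs2 _ (subset_tsupport _ fun h => hp (by simp [h]))).trans (le_max_right _ _)

theorem integral_logKernel_mul_mul {f g : Plane → ℝ} (hf : Continuous f)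
    (hfc : HasCompactSupport f) (hg : Continuous g) (hgc : HasCompactSupport g) :
    ∫ p : Plane × Plane, logKernel (p.1 - p.2) * f p.1 * g p.2 = ∫ x, f x * potential g x := by
  have h := integrable_comp_sub_mul_mul locallyIntegrable_logKernel hf hfc hg hgc
  rw [Measure.volume_eq_prod, integral_prod _ h]
  refine integral_congr_ae (Eventually.of_forall fun x => ?_)
  simp only [potential]
  rw [← integral_const_mul]
  congr with y
  ring

theorem logKernel_sub_comm (x y : Plane) : logKernel (x - y) = logKernel (y - x) := by
  rw [logKernel, logKernel, norm_sub_rev]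

theorem integral_mul_potential_comm {f g : Plane → ℝ} (hf : Continuous f)
    (hfc : HasCompactSupport f) (hg : Continuous g) (hgc : HasCompactSupport g) :
    ∫ x, f x * potential g x = ∫ x, g x * potential f x := by
  rw [← integral_logKernel_mul_mul hf hfc hg hgc, ← integral_logKernel_mul_mul hg hgc hf hfc,
    Measure.volume_eq_prod, ← integral_prod_swap]
  congr with p
  rw [Prod.fst_swap, Prod.snd_swap, logKernel_sub_comm]
  ring

/-- The energy of a solution is conserved. -/
theorem IsEulerSolution.integral_mul_potential_eq {w₀ : Plane → ℝ} {w : ℝ → Plane → ℝ}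
    (h : IsEulerSolution w₀ w) (hc : HasCompactSupport w₀) {T : ℝ} (hT : 0 ≤ T) :
    ∫ x, w T x * potential (w T) x = ∫ x, w₀ x * potential w₀ x := by
  obtain ⟨R, B, hB, hbd⟩ := h.exists_bound hc hT
  have hw : ∀ t ∈ Icc 0 T, ContDiff ℝ 1 (w t) := fun t ht => contDiff_slice h.contDiffOn ht.1
  have hcs : ∀ t ∈ Icc 0 T, HasCompactSupport (w t) := fun t ht =>
    hasCompactSupport_of_norm_lt fun x hx => ((hbd t ht x).2.2 hx).1
  have hr : ∀ t ∈ Icc 0 T, Continuous (vorticityRate (w t)) := fun t ht =>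
    continuous_vorticityRate (hw t ht) (hcs t ht)
  have hrc : ∀ t ∈ Icc 0 T, HasCompactSupport (vorticityRate (w t)) := fun t ht =>
    hasCompactSupport_of_norm_lt fun x hx => ((hbd t ht x).2.2 hx).2
  have hT' : T ∈ Icc 0 T := ⟨hT, le_rfl⟩
  have h0' : (0 : ℝ) ∈ Icc 0 T := ⟨le_rfl, hT⟩
  -- As a double integral with a fixed kernel, the energy depends on time only through pointwise
  -- values of w, so the potential itself need not be differentiated in time.
  rw [← h.initial, ← integral_logKernel_mul_mul (hw T hT').continuous (hcs T hT')
    (hw T hT').continuous (hcs T hT'), ← integral_logKernel_mul_mul (hw 0 h0').continuous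
    (hcs 0 h0') (hw 0 h0').continuous (hcs 0 h0')]
  set S := Metric.closedBall (0 : Plane) R ×ˢ Metric.closedBall (0 : Plane) R with hS
  have hSm : MeasurableSet S := (Metric.isClosed_closedBall.prod
    Metric.isClosed_closedBall).measurableSet
  have hkm : Measurable fun p : Plane × Plane => logKernel (p.1 - p.2) :=
    measurable_logKernel.comp (by fun_prop)
  have i1 := fun t ht => integrable_comp_sub_mul_mul locallyIntegrable_logKernel
    (hr t ht) (hrc t ht) (hw t ht).continuous (hcs t ht)
  have i2 := fun t ht => integrable_comp_sub_mul_mul locallyIntegrable_logKernel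
    (hw t ht).continuous (hcs t ht) (hr t ht) (hrc t ht)
  have hout : ∀ p ∉ S, R < ‖p.1‖ ∨ R < ‖p.2‖ := fun p hp => by
    by_contra! hcon
    exact hp ⟨mem_closedBall_zero_iff.2 hcon.1, mem_closedBall_zero_iff.2 hcon.2⟩
  refine integral_eq_of_integral_deriv_eq_zero
    (f := fun t (p : Plane × Plane) => logKernel (p.1 - p.2) * w t p.1 * w t p.2)
    (f' := fun t p => logKernel (p.1 - p.2) * vorticityRate (w t) p.1 * w t p.2
      + logKernel (p.1 - p.2) * w t p.1 * vorticityRate (w t) p.2)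
    (bound := S.indicator fun p => |logKernel (p.1 - p.2)| * (B * B + B * B)) hT ?_ ?_ ?_ ?_ ?_
    ?_ ?_ ?_
  · rw [integrable_indicator_iff hSm]
    exact (integrableOn_comp_sub locallyIntegrable_logKernel R).abs.mul_const _
  · intro t ht
    exact (integrable_comp_sub_mul_mul locallyIntegrable_logKernel (hw t ht).continuous
      (hcs t ht) (hw t ht).continuous (hcs t ht)).aestronglyMeasurable
  · exact fun t ht => ((i1 t ht).add (i2 t ht)).aestronglyMeasurable
  · intro t ht p
    by_cases hp : p ∈ S
    · rw [indicator_of_mem hp, norm_mul, norm_mul, mul_assoc]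
      have := (hbd t ht p.1).1
      have := (hbd t ht p.2).1
      simp only [Real.norm_eq_abs]
      gcongr
      calc _ ≤ B * B := by gcongr
        _ ≤ _ := le_add_of_nonneg_right (by positivity)
    · rw [indicator_of_notMem hp]
      rcases hout p hp with hp | hp
      · simp [((hbd t ht p.1).2.2 hp).1]
      · simp [((hbd t ht p.2).2.2 hp).1]
  · intro t ht p
    by_cases hp : p ∈ S
    · rw [indicator_of_mem hp, mul_assoc, mul_assoc, ← mul_add, norm_mul]
      obtain ⟨b1, b2, -⟩ := hbd t ht p.1
      obtain ⟨b3, b4, -⟩ := hbd t ht p.2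
      rw [Real.norm_eq_abs]
      gcongr
      refine (norm_add_le _ _).trans ?_
      simp only [norm_mul, Real.norm_eq_abs]
      gcongr
    · rw [indicator_of_notMem hp]
      rcases hout p hp with hp | hp
      · simp [((hbd t ht p.1).2.2 hp).1, ((hbd t ht p.1).2.2 hp).2]
      · simp [((hbd t ht p.2).2.2 hp).1, ((hbd t ht p.2).2.2 hp).2]
  · intro p
    exact (continuousOn_const.mul (h.continuousOn_time p.1 T)).mul (h.continuousOn_time p.2 T)
  · intro t ht p
    exact ((h.hasDerivAt_time p.1 ht.1).const_mul _).mul (h.hasDerivAt_time p.2 ht.1)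
  · intro t ht
    have ht := Ioo_subset_Icc_self ht
    -- Symmetry of the kernel turns the second half of the product rule into the first.
    rw [integral_add (i1 t ht) (i2 t ht), integral_logKernel_mul_mul (hr t ht) (hrc t ht)
      (hw t ht).continuous (hcs t ht), integral_logKernel_mul_mul (hw t ht).continuous
      (hcs t ht) (hr t ht) (hrc t ht), integral_mul_potential_comm (hw t ht).continuous
      (hcs t ht) (hr t ht) (hrc t ht),
      integral_vorticityRate_mul_potential (hw t ht) (hcs t ht), add_zero]

/-! ### The energy of a thinned vorticity. -/

/-- The area preserving map `x ↦ (a x₁, a⁻¹ x₂)`. -/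
def squeeze {a : ℝ} (ha : a ≠ 0) : Plane ≃L[ℝ] Plane :=
  LinearEquiv.toContinuousLinearEquiv
    { toFun := fun x => !₂[a * x 0, a⁻¹ * x 1]
      invFun := fun x => !₂[a⁻¹ * x 0, a * x 1]
      map_add' := fun x y => by ext i; fin_cases i <;> simp <;> ring
      map_smul' := fun c x => by ext i; fin_cases i <;> simp <;> ring
      left_inv := fun x => by ext i; fin_cases i <;> simp [ha]
      right_inv := fun x => by ext i; fin_cases i <;> simp [ha] }

theorem squeeze_apply {a : ℝ} (ha : a ≠ 0) (x : Plane) :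
    squeeze ha x = !₂[a * x 0, a⁻¹ * x 1] := rfl

theorem squeeze_symm_apply {a : ℝ} (ha : a ≠ 0) (x : Plane) :
    (squeeze ha).symm x = !₂[a⁻¹ * x 0, a * x 1] := rfl

theorem measurePreserving_squeeze {a : ℝ} (ha : a ≠ 0) : MeasurePreserving (squeeze ha) := by
  set D : Matrix (Fin 2) (Fin 2) ℝ := Matrix.diagonal ![a, a⁻¹] with hD
  have hdet : D.det = 1 := by simp [hD, Matrix.det_diagonal, Fin.prod_univ_two, ha]
  have h1 : MeasurePreserving (Matrix.toLin' D) := by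
    refine ⟨(LinearMap.continuous_of_finiteDimensional _).measurable, ?_⟩
    rw [Real.map_matrix_volume_pi_eq_smul_volume_pi (by rw [hdet]; exact one_ne_zero), hdet]
    simp
  have h2 := ((PiLp.volume_preserving_toLp (Fin 2)).comp h1).comp
    (PiLp.volume_preserving_ofLp (Fin 2))
  convert h2 using 1
  ext x i
  fin_cases i <;> simp [squeeze_apply, hD]

theorem thinned_eq {M t : ℝ} (h : M * t ≠ 0) (w : Plane → ℝ) :
    thinned M t w = w ∘ squeeze h := rfl

theorem contDiff_thinned {M t : ℝ} (h : M * t ≠ 0) {w : Plane → ℝ} (hw : ContDiff ℝ 1 w) :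
    ContDiff ℝ 1 (thinned M t w) := by
  rw [thinned_eq h]; exact hw.comp (squeeze h).contDiff

theorem hasCompactSupport_thinned {M t : ℝ} (h : M * t ≠ 0) {w : Plane → ℝ}
    (hc : HasCompactSupport w) : HasCompactSupport (thinned M t w) := by
  rw [thinned_eq h]; exact hc.comp_homeomorph (squeeze h).toHomeomorph

theorem integral_thinned {M t : ℝ} (h : M * t ≠ 0) (w : Plane → ℝ) :
    ∫ x, thinned M t w x = ∫ x, w x := by
  rw [thinned_eq h]
  exact (measurePreserving_squeeze h).integral_comp
    (squeeze h).toHomeomorph.measurableEmbedding w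

/-- The singularity fills a line, but across it is that of the one-dimensional logarithm, which is
integrable on intervals. -/
theorem locallyIntegrable_log_coord : LocallyIntegrable fun z : Plane => Real.log (z 1) := by
  rw [locallyIntegrable_iff]
  intro K hK
  obtain ⟨R, hR, hsub⟩ := hK.isBounded.exists_pos_norm_le
  have h1 : IntegrableOn Real.log (Icc (-R) R) := by
    rw [integrableOn_Icc_iff_integrableOn_Ioc, ← intervalIntegrable_iff_integrableOn_Ioc_of_le
      (by linarith)]
    exact intervalIntegral.intervalIntegrable_log'
  have h2 : IntegrableOn (fun p : ℝ × ℝ => Real.log p.2) (Icc (-R) R ×ˢ Icc (-R) R) := by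
    rw [IntegrableOn, Measure.volume_eq_prod, ← Measure.prod_restrict]
    exact Integrable.comp_snd h1 _
  have h3 := (measurePreserving_planeEquiv.integrableOn_comp_preimage
    planeEquiv.measurableEmbedding).2 h2
  refine h3.mono_set fun x hx => ?_
  have hb : ∀ i, |x i| ≤ R := fun i => (PiLp.norm_apply_le x i).trans (hsub x hx)
  exact ⟨abs_le.1 (hb 0), abs_le.1 (hb 1)⟩

theorem ae_coord_ne_zero : ∀ᵐ z : Plane, z 1 ≠ 0 := by
  have h : ∀ᵐ p : ℝ × ℝ, p.2 ≠ 0 := by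
    have h1 : ∀ᵐ t : ℝ, t ≠ 0 := compl_mem_ae_iff.2 (measure_singleton 0)
    exact (Measure.quasiMeasurePreserving_snd (μ := (volume : Measure ℝ))
      (ν := (volume : Measure ℝ))).ae h1
  exact measurePreserving_planeEquiv.quasiMeasurePreserving.ae h

theorem ae_coord_sub_ne_zero : ∀ᵐ p : Plane × Plane, (p.1 - p.2) 1 ≠ 0 :=
  (quasiMeasurePreserving_sub (volume : Measure Plane) (volume : Measure Plane)).ae
    ae_coord_ne_zero

theorem locallyIntegrable_log_sq_bound :
    LocallyIntegrable fun z : Plane => 2 * |Real.log (z 1)| + ‖z‖ ^ 2 := by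
  have habs : LocallyIntegrable fun z : Plane => |Real.log (z 1)| :=
    locallyIntegrable_log_coord.mono
      (by fun_prop : Measurable fun z : Plane => |Real.log (z 1)|).aestronglyMeasurable
      (Eventually.of_forall fun z => by simp)
  exact (habs.smul (2 : ℝ)).add (by fun_prop : Continuous fun z : Plane => ‖z‖ ^ 2).locallyIntegrable

/-- The logarithmic energy of the anisotropic quadratic form `z₂² + (e z₁)²`. -/
def anisotropicEnergy (w : Plane → ℝ) (e : ℝ) : ℝ :=
  ∫ p : Plane × Plane,
    Real.log ((p.1 - p.2) 1 ^ 2 + (e * (p.1 - p.2) 0) ^ 2) * w p.1 * w p.2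

theorem norm_anisotropic_le (w : Plane → ℝ) {e : ℝ} (he : |e| ≤ 1) {p : Plane × Plane}
    (hp : (p.1 - p.2) 1 ≠ 0) :
    ‖Real.log ((p.1 - p.2) 1 ^ 2 + (e * (p.1 - p.2) 0) ^ 2) * w p.1 * w p.2‖
      ≤ (2 * |Real.log ((p.1 - p.2) 1)| + ‖p.1 - p.2‖ ^ 2) * |w p.1| * |w p.2| := by
  rw [norm_mul, norm_mul, Real.norm_eq_abs, Real.norm_eq_abs, Real.norm_eq_abs]
  gcongr
  refine (abs_log_sq_add_sq_le hp).trans ?_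
  rw [EuclideanSpace.real_norm_sq_eq, Fin.sum_univ_two, add_comm (_ ^ 2)]
  have h1 : e ^ 2 ≤ 1 := by rw [← sq_abs]; exact pow_le_one₀ (abs_nonneg _) he
  have h2 := mul_le_of_le_one_left (sq_nonneg ((p.1 - p.2) 0)) h1
  rw [← mul_pow] at h2
  linarith

theorem integrable_anisotropic_bound {w : Plane → ℝ} (hw : Continuous w)
    (hc : HasCompactSupport w) : Integrable fun p : Plane × Plane =>
      (2 * |Real.log ((p.1 - p.2) 1)| + ‖p.1 - p.2‖ ^ 2) * |w p.1| * |w p.2| :=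
  integrable_comp_sub_mul_mul locallyIntegrable_log_sq_bound hw.abs hc.abs hw.abs hc.abs

theorem measurable_anisotropic {w : Plane → ℝ} (hw : Continuous w) (e : ℝ) :
    Measurable fun p : Plane × Plane =>
      Real.log ((p.1 - p.2) 1 ^ 2 + (e * (p.1 - p.2) 0) ^ 2) * w p.1 * w p.2 := by
  have := hw.measurable
  fun_prop

theorem integrable_anisotropic {w : Plane → ℝ} (hw : Continuous w)
    (hc : HasCompactSupport w) {e : ℝ} (he : |e| ≤ 1) : Integrable fun p : Plane × Plane =>
      Real.log ((p.1 - p.2) 1 ^ 2 + (e * (p.1 - p.2) 0) ^ 2) * w p.1 * w p.2 := by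
  refine (integrable_anisotropic_bound hw hc).mono' (measurable_anisotropic hw e).aestronglyMeasurable
    ?_
  filter_upwards [ae_coord_sub_ne_zero] with p hp using norm_anisotropic_le w he hp

/-- Dominated convergence: for |e| ≤ 1 the kernel is bounded, off the null set where the second
coordinates agree, by one locally integrable function independent of e. -/
theorem tendsto_anisotropicEnergy {w : Plane → ℝ} (hw : Continuous w)
    (hc : HasCompactSupport w) :
    Tendsto (anisotropicEnergy w) (𝓝 0) (𝓝 (anisotropicEnergy w 0)) := by
  refine tendsto_integral_filter_of_dominated_convergence _ (Eventually.of_forall fun e =>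
    (measurable_anisotropic hw e).aestronglyMeasurable) ?_ (integrable_anisotropic_bound hw hc) ?_
  · filter_upwards [Metric.closedBall_mem_nhds (0 : ℝ) one_pos] with e he
    filter_upwards [ae_coord_sub_ne_zero] with p hp
    exact norm_anisotropic_le w (by simpa using he) hp
  · filter_upwards [ae_coord_sub_ne_zero] with p hp
    refine Tendsto.mul_const _ (Tendsto.mul_const _ (Tendsto.log ?_ (by positivity)))
    exact Continuous.tendsto (by fun_prop) 0

/-- At e = 0 the kernel depends only on the second coordinates, so for fixed x integrating first in
y₁ sees only the horizontal integrals of `w`. -/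
theorem anisotropicEnergy_zero {w : Plane → ℝ} (hw : Continuous w) (hc : HasCompactSupport w)
    (h0 : ∀ x₂ : ℝ, ∫ x₁ : ℝ, w !₂[x₁, x₂] = 0) : anisotropicEnergy w 0 = 0 := by
  have hint := integrable_anisotropic hw hc (e := 0) (by simp)
  rw [anisotropicEnergy, Measure.volume_eq_prod, integral_prod _ hint]
  refine integral_eq_zero_of_ae (Eventually.of_forall fun x => ?_)
  simp only [zero_mul, ne_eq, OfNat.ofNat_ne_zero, not_false_eq_true, zero_pow, add_zero,
    Pi.zero_apply]
  have hi : Integrable fun y : Plane => Real.log ((x - y) 1) * w y :=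
    integrable_comp_sub_mul locallyIntegrable_log_coord hw hc x
  have e : ∀ y : Plane, Real.log ((x - y) 1 ^ 2) * w x * w y
      = 2 * w x * (Real.log ((x - y) 1) * w y) := fun y => by
    rw [Real.log_pow]; push_cast; ring
  simp_rw [e]
  rw [integral_const_mul]
  refine mul_eq_zero_of_right _ ?_
  have hi2 := measurePreserving_planeEquiv.symm.integrable_comp_of_integrable hi
  rw [← measurePreserving_planeEquiv.symm.integral_comp planeEquiv.symm.measurableEmbedding]
  have e2 : ∀ p : ℝ × ℝ, Real.log ((x - planeEquiv.symm p) 1) * w (planeEquiv.symm p)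
      = Real.log (x 1 - p.2) * w !₂[p.1, p.2] := fun p => by
    rw [planeEquiv_symm_apply]; simp
  simp only [Function.comp_def, e2] at hi2 ⊢
  rw [Measure.volume_eq_prod, integral_prod_symm _ hi2]
  simp only [integral_const_mul, h0, mul_zero, integral_zero]

/-- The factor a² comes out of |(a⁻¹z₁, a z₂)|² = a² (z₂² + a⁻⁴ z₁²); z₂ ≠ 0 keeps the argument of
the logarithm positive. -/
theorem logKernel_squeeze_symm {a : ℝ} (ha : a ≠ 0) {z : Plane} (hz : z 1 ≠ 0) :
    logKernel ((squeeze ha).symm z)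
      = (4 * Real.pi)⁻¹ * (2 * Real.log a + Real.log (z 1 ^ 2 + ((a ^ 2)⁻¹ * z 0) ^ 2)) := by
  have h1 : ‖(squeeze ha).symm z‖ ^ 2 = a ^ 2 * (z 1 ^ 2 + ((a ^ 2)⁻¹ * z 0) ^ 2) := by
    rw [EuclideanSpace.real_norm_sq_eq, Fin.sum_univ_two, squeeze_symm_apply]
    simp
    field_simp
    ring
  have h2 : 2 * Real.log ‖(squeeze ha).symm z‖ = Real.log (‖(squeeze ha).symm z‖ ^ 2) := by
    rw [Real.log_pow]; norm_num
  have h3 : 2 * Real.log a = Real.log (a ^ 2) := by rw [Real.log_pow]; norm_num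
  rw [h3, ← Real.log_mul (by positivity) (by positivity), ← h1, ← h2, logKernel]
  field_simp
  ring

/-- Squeezing both variables preserves measure and transfers the deformation to the kernel. The
condition 1 ≤ Mt places the parameter in the range |e| ≤ 1 of the domination. -/
theorem integral_thinned_mul_potential {M t : ℝ} (h : 1 ≤ M * t) {w : Plane → ℝ}
    (hw : Continuous w) (hc : HasCompactSupport w) (hm : ∫ x, w x = 0) :
    ∫ x, thinned M t w x * potential (thinned M t w) x
      = (4 * Real.pi)⁻¹ * anisotropicEnergy w ((M * t) ^ 2)⁻¹ := by
  have ha : M * t ≠ 0 := by positivity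
  have hcont : Continuous (thinned M t w) := by
    rw [thinned_eq ha]; exact hw.comp (squeeze ha).continuous
  have hcs := hasCompactSupport_thinned ha hc
  have he : |((M * t) ^ 2)⁻¹| ≤ 1 := by
    rw [abs_of_nonneg (by positivity)]
    exact inv_le_one_of_one_le₀ (one_le_pow₀ h)
  have hwi := hw.integrable_of_hasCompactSupport (μ := volume) hc
  rw [← integral_logKernel_mul_mul hcont hcs hcont hcs]
  have e1 : ∀ p : Plane × Plane, logKernel (p.1 - p.2) * thinned M t w p.1 * thinned M t w p.2
      = (fun q : Plane × Plane => logKernel ((squeeze ha).symm (q.1 - q.2)) * w q.1 * w q.2)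
        (Prod.map (squeeze ha) (squeeze ha) p) := fun p => by
    simp only [Prod.map_fst, Prod.map_snd, ← map_sub, ContinuousLinearEquiv.symm_apply_apply,
      thinned_eq ha, Function.comp_apply]
  rw [integral_congr_ae (Eventually.of_forall e1)]
  have hmp : MeasurePreserving (Prod.map (squeeze ha) (squeeze ha)) :=
    (measurePreserving_squeeze ha).prod (measurePreserving_squeeze ha)
  refine (hmp.integral_comp ((squeeze ha).toHomeomorph.prodCongr
    (squeeze ha).toHomeomorph).measurableEmbedding
    (fun q : Plane × Plane => logKernel ((squeeze ha).symm (q.1 - q.2)) * w q.1 * w q.2)).trans ?_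
  have e2 : ∫ q : Plane × Plane, logKernel ((squeeze ha).symm (q.1 - q.2)) * w q.1 * w q.2
      = ∫ q : Plane × Plane, ((4 * Real.pi)⁻¹ * (2 * Real.log (M * t)) * (w q.1 * w q.2)
        + (4 * Real.pi)⁻¹ * (Real.log ((q.1 - q.2) 1 ^ 2
          + (((M * t) ^ 2)⁻¹ * (q.1 - q.2) 0) ^ 2) * w q.1 * w q.2)) := by
    refine integral_congr_ae ?_
    filter_upwards [ae_coord_sub_ne_zero] with q hq
    rw [logKernel_squeeze_symm ha hq]
    ring
  have hww : Integrable fun q : Plane × Plane => w q.1 * w q.2 := hwi.mul_prod hwi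
  -- This removes the constant 2 log (Mt), which is unbounded as M → ∞.
  have hww0 : ∫ q : Plane × Plane, w q.1 * w q.2 = 0 := by
    rw [Measure.volume_eq_prod, integral_prod_mul, hm, mul_zero]
  rw [e2, integral_add (hww.const_mul _) ((integrable_anisotropic hw hc he).const_mul _),
    integral_const_mul, integral_const_mul, hww0, mul_zero, zero_add]
  rfl

theorem tendsto_l2Norm_thinned {w : Plane → ℝ} (hw : ContDiff ℝ 1 w) (hc : HasCompactSupport w)
    (hm : ∫ x, w x = 0) (h0 : ∀ x₂ : ℝ, ∫ x₁ : ℝ, w !₂[x₁, x₂] = 0) {t : ℝ} (ht : 0 < t) :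
    Tendsto (fun M : ℝ => l2Norm (biotSavart (thinned M t w))) atTop (𝓝 0) := by
  have hat : Tendsto (fun M : ℝ => M * t) atTop atTop := tendsto_id.atTop_mul_const ht
  have h1 : Tendsto (fun M : ℝ => ((M * t) ^ 2)⁻¹) atTop (𝓝 0) :=
    tendsto_inv_atTop_zero.comp ((tendsto_pow_atTop two_ne_zero).comp hat)
  have h2 := (tendsto_anisotropicEnergy hw.continuous hc).comp h1
  rw [anisotropicEnergy_zero hw.continuous hc h0] at h2
  have h3 : Tendsto (fun M : ℝ => l2Norm (biotSavart (thinned M t w)) ^ 2) atTop (𝓝 0) := by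
    have h4 := (h2.const_mul (4 * Real.pi)⁻¹).neg
    rw [mul_zero, neg_zero] at h4
    refine h4.congr' ?_
    filter_upwards [hat.eventually_ge_atTop 1] with M hM
    have ha : M * t ≠ 0 := by positivity
    rw [l2Norm_biotSavart_sq (contDiff_thinned ha hw) (hasCompactSupport_thinned ha hc)
      ((integral_thinned ha w).trans hm), integral_thinned_mul_potential hM hw.continuous hc hm]
    rfl
  have h5 := h3.sqrt
  rw [Real.sqrt_zero] at h5
  refine h5.congr fun M => Real.sqrt_sq ENNReal.toReal_nonneg

/-! ### Linearity, L² algebra and the lower bound for the large-scale velocity. -/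

theorem biotSavart_add {v w : Plane → ℝ} (hv : Continuous v) (hvc : HasCompactSupport v)
    (hw : Continuous w) (hwc : HasCompactSupport w) :
    biotSavart (v + w) = biotSavart v + biotSavart w := by
  ext1 x
  rw [Pi.add_apply, biotSavart_eq, biotSavart_eq, biotSavart_eq, ← map_add, gradPotential,
    gradPotential, gradPotential, ← integral_add (integrable_smul_gradKernel hv hvc x)
    (integrable_smul_gradKernel hw hwc x)]
  simp_rw [Pi.add_apply, add_smul]

theorem biotSavart_smul (c : ℝ) (w : Plane → ℝ) : biotSavart (c • w) = c • biotSavart w := by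
  ext1 x
  rw [Pi.smul_apply, biotSavart, biotSavart, ← integral_smul]
  simp_rw [Pi.smul_apply, smul_assoc]

theorem l2Norm_nonneg (u : Plane → Plane) : 0 ≤ l2Norm u := ENNReal.toReal_nonneg

theorem l2Norm_add_le {u v : Plane → Plane} (hu : MemLp u 2) (hv : MemLp v 2) :
    l2Norm (u + v) ≤ l2Norm u + l2Norm v := by
  rw [l2Norm, l2Norm, l2Norm, ← ENNReal.toReal_add hu.eLpNorm_ne_top hv.eLpNorm_ne_top]
  exact ENNReal.toReal_mono (ENNReal.add_ne_top.2 ⟨hu.eLpNorm_ne_top, hv.eLpNorm_ne_top⟩)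
    (eLpNorm_add_le hu.aestronglyMeasurable hv.aestronglyMeasurable (by norm_num))

theorem l2Norm_add_smul_sq {u v : Plane → Plane} (hu : MemLp u 2) (hv : MemLp v 2) (c : ℝ) :
    l2Norm (c • u + v) ^ 2
      = c ^ 2 * l2Norm u ^ 2 + 2 * (c * ∫ x, inner ℝ (u x) (v x)) + l2Norm v ^ 2 := by
  have hi : Integrable fun x => inner ℝ (u x) (v x) := by
    refine (hu.norm.integrable_mul hv.norm).mono'
      (hu.aestronglyMeasurable.inner hv.aestronglyMeasurable) (Eventually.of_forall fun x => ?_)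
    exact norm_inner_le_norm (u x) (v x)
  have hu2 := (memLp_two_iff_integrable_sq_norm hu.aestronglyMeasurable).1 hu
  have hv2 := (memLp_two_iff_integrable_sq_norm hv.aestronglyMeasurable).1 hv
  have h1 : Integrable fun x => c ^ 2 * ‖u x‖ ^ 2 + 2 * (c * inner ℝ (u x) (v x)) :=
    (hu2.const_mul _).add ((hi.const_mul _).const_mul _)
  rw [l2Norm_sq ((hu.const_smul c).add hv), l2Norm_sq hu, l2Norm_sq hv, ← integral_const_mul,
    ← integral_const_mul, ← integral_const_mul,
    ← integral_add (hu2.const_mul _) ((hi.const_mul _).const_mul _),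
    ← integral_add h1 hv2]
  congr with x
  rw [Pi.add_apply, Pi.smul_apply, norm_add_sq_real, norm_smul, mul_pow, Real.norm_eq_abs, sq_abs,
    real_inner_smul_left]

/-- The kinetic energy of a solution is conserved. -/
theorem IsEulerSolution.l2Norm_biotSavart_eq {w₀ : Plane → ℝ} {w : ℝ → Plane → ℝ}
    (h : IsEulerSolution w₀ w) (hc : HasCompactSupport w₀) (hm : ∫ x, w₀ x = 0) {t : ℝ}
    (ht : 0 ≤ t) :
    ContDiff ℝ 1 (w t) ∧ HasCompactSupport (w t) ∧ ∫ x, w t x = 0 ∧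
      l2Norm (biotSavart (w t)) = l2Norm (biotSavart w₀) := by
  have key : ∀ s ∈ Icc 0 t, ContDiff ℝ 1 (w s) ∧ HasCompactSupport (w s) ∧ ∫ x, w s x = 0 := by
    intro s hs
    obtain ⟨R, hR⟩ := h.exists_support hc hs.1
    exact ⟨contDiff_slice h.contDiffOn hs.1,
      hasCompactSupport_of_norm_lt (hR s ⟨hs.1, le_rfl⟩), (h.integral_eq hc hs.1).trans hm⟩
  obtain ⟨a1, a2, a3⟩ := key t ⟨ht, le_rfl⟩
  obtain ⟨b1, b2, b3⟩ := key 0 ⟨le_rfl, ht⟩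
  refine ⟨a1, a2, a3, ?_⟩
  rw [← sq_eq_sq₀ (l2Norm_nonneg _) (l2Norm_nonneg _), ← h.initial,
    l2Norm_biotSavart_sq a1 a2 a3, l2Norm_biotSavart_sq b1 b2 b3,
    h.integral_mul_potential_eq hc ht, h.initial]

/-- Energy conservation bounds the large-scale velocity of a thinning splitting from below,
provided the initial velocities are non-negatively correlated. -/
theorem IsThinningSplitting.le_l2Norm {M : ℝ} (hM : 0 < M) {v₀ w₀ : Plane → ℝ}
    {v w : ℝ → Plane → ℝ} (h : IsThinningSplitting M v₀ w₀ v w) (hv : ContDiff ℝ 1 v₀)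
    (hvc : HasCompactSupport v₀) (hvm : ∫ x, v₀ x = 0) (hw : ContDiff ℝ 1 w₀)
    (hwc : HasCompactSupport w₀) (hwm : ∫ x, w₀ x = 0)
    (hcor : 0 ≤ ∫ x, inner ℝ (biotSavart v₀ x) (biotSavart w₀ x)) {t : ℝ} (ht : 0 ≤ t) :
    MemLp (biotSavart (v t)) 2 ∧ MemLp (biotSavart (w t)) 2 ∧
      Real.sqrt (l2Norm (biotSavart w₀) ^ 2 + l2Norm (biotSavart v₀) ^ 2)
        - l2Norm (biotSavart (v t)) ≤ l2Norm (biotSavart (w t)) := by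
  have hsc : HasCompactSupport (v₀ + w₀) := hvc.add hwc
  have hsm : ∫ x, (v₀ + w₀) x = 0 := by
    simp only [Pi.add_apply]
    rw [integral_add (hv.continuous.integrable_of_hasCompactSupport hvc)
      (hw.continuous.integrable_of_hasCompactSupport hwc), hvm, hwm, add_zero]
  obtain ⟨a1, a2, a3, a4⟩ := h.solution.l2Norm_biotSavart_eq hsc hsm ht
  have hvt : ContDiff ℝ 1 (v t) ∧ HasCompactSupport (v t) ∧ ∫ x, v t x = 0 := by
    rcases ht.eq_or_lt with rfl | ht
    · rw [h.initial_small]; exact ⟨hv, hvc, hvm⟩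
    · have ha : M * t ≠ 0 := by positivity
      rw [h.thinning t ht]
      exact ⟨contDiff_thinned ha hv, hasCompactSupport_thinned ha hvc,
        (integral_thinned ha v₀).trans hvm⟩
  obtain ⟨b1, b2, b3⟩ := hvt
  -- The splitting assumes no regularity of the large-scale part; it is inherited from the solution
  -- and the thinned part.
  have hwt : w t = (v t + w t) - v t := by simp
  have c1 : ContDiff ℝ 1 (w t) := by rw [hwt]; exact a1.sub b1
  have c2 : HasCompactSupport (w t) := by
    rw [hwt, sub_eq_add_neg]; exact a2.add b2.neg
  have c3 : ∫ x, w t x = 0 := by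
    have e : ∀ x, (v t + w t) x = v t x + w t x := fun _ => rfl
    simp_rw [e] at a3
    rwa [integral_add (b1.continuous.integrable_of_hasCompactSupport b2)
      (c1.continuous.integrable_of_hasCompactSupport c2), b3, zero_add] at a3
  have mv := memLp_biotSavart b1 b2 b3
  have mw := memLp_biotSavart c1 c2 c3
  refine ⟨mv, mw, ?_⟩
  rw [biotSavart_add b1.continuous b2 c1.continuous c2,
    biotSavart_add hv.continuous hvc hw.continuous hwc] at a4
  have h1 := l2Norm_add_le mv mw
  have h2 := l2Norm_add_smul_sq (memLp_biotSavart hv hvc hvm) (memLp_biotSavart hw hwc hwm) 1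
  rw [one_smul] at h2
  -- In the expanded square of the sum the cross term is nonnegative by `hcor`.
  have h3 : Real.sqrt (l2Norm (biotSavart w₀) ^ 2 + l2Norm (biotSavart v₀) ^ 2)
      ≤ l2Norm (biotSavart v₀ + biotSavart w₀) := by
    refine Real.sqrt_le_iff.2 ⟨l2Norm_nonneg _, ?_⟩
    rw [h2]
    linarith
  linarith

end

/-! ### The main theorem. -/

theorem mainTheorem3 (ωS₀ ωL₀ : Plane → ℝ)
    (hS : ContDiff ℝ ∞ ωS₀) (hL : ContDiff ℝ ∞ ωL₀)
    (hSc : HasCompactSupport ωS₀) (hLc : HasCompactSupport ωL₀)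
    (hSm : ∫ x, ωS₀ x = 0) (hLm : ∫ x, ωL₀ x = 0)
    (hdisj : Disjoint (tsupport ωS₀) (tsupport ωL₀)) :
    ∃ σ : ℝ, (σ = 1 ∨ σ = -1) ∧
      MemLp (biotSavart ωL₀) 2 volume ∧ MemLp (biotSavart ωS₀) 2 volume ∧
      (∀ M : ℝ, 1 < M → ∀ ωS ωL : ℝ → Plane → ℝ,
        IsThinningSplitting M (σ • ωS₀) ωL₀ ωS ωL →
        ∀ t : ℝ, 0 ≤ t →
          MemLp (biotSavart (ωS t)) 2 volume ∧ MemLp (biotSavart (ωL t)) 2 volume ∧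
          Real.sqrt (l2Norm (biotSavart ωL₀) ^ 2 + l2Norm (biotSavart ωS₀) ^ 2)
              - l2Norm (biotSavart (ωS t))
            ≤ l2Norm (biotSavart (ωL t))) ∧
      ((∀ x₂ : ℝ, ∫ x₁ : ℝ, ωS₀ !₂[x₁, x₂] = 0) →
        ∀ t ∈ Ioc (0 : ℝ) 1,
          (∀ M : ℝ, 1 < M → MemLp (biotSavart (thinned M t (σ • ωS₀))) 2 volume) ∧
          Tendsto (fun M : ℝ => l2Norm (biotSavart (thinned M t (σ • ωS₀))))
            atTop (𝓝 0)) := by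

  have hS1 : ContDiff ℝ 1 ωS₀ := hS.of_le (by exact_mod_cast le_top)
  have hL1 : ContDiff ℝ 1 ωL₀ := hL.of_le (by exact_mod_cast le_top)
  have mS := memLp_biotSavart hS1 hSc hSm
  have mL := memLp_biotSavart hL1 hLc hLm
  -- The sign depends only on the initial pairing, so it is fixed before M and the solution are
  -- chosen.
  obtain ⟨σ, hσ, hcor⟩ : ∃ σ : ℝ, (σ = 1 ∨ σ = -1) ∧
      0 ≤ σ * ∫ x, inner ℝ (biotSavart ωS₀ x) (biotSavart ωL₀ x) := by
    rcases le_total 0 (∫ x, inner ℝ (biotSavart ωS₀ x) (biotSavart ωL₀ x)) with h | h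
    · exact ⟨1, Or.inl rfl, by linarith⟩
    · exact ⟨-1, Or.inr rfl, by linarith⟩
  have hσS : ContDiff ℝ 1 (σ • ωS₀) := contDiff_const.smul hS1
  have hσc : HasCompactSupport (σ • ωS₀) := hSc.smul_left (f := fun _ => σ)
  have hσm : ∫ x, (σ • ωS₀) x = 0 := by
    simp only [Pi.smul_apply]
    rw [integral_smul, hSm, smul_zero]
  refine ⟨σ, hσ, mL, mS, fun M hM ωS ωL h t ht => ?_, fun h0 t ht => ⟨fun M hM => ?_, ?_⟩⟩
  · have hcor' : 0 ≤ ∫ x, inner ℝ (biotSavart (σ • ωS₀) x) (biotSavart ωL₀ x) := by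
      simp_rw [biotSavart_smul, Pi.smul_apply, real_inner_smul_left]
      rwa [integral_const_mul]
    have hnorm : l2Norm (biotSavart (σ • ωS₀)) = l2Norm (biotSavart ωS₀) := by
      rw [biotSavart_smul, l2Norm, l2Norm, eLpNorm_const_smul]
      rcases hσ with rfl | rfl <;> simp
    rw [← hnorm]
    exact h.le_l2Norm (by linarith) hσS hσc hσm hL1 hLc hLm hcor' ht
  · have ha : M * t ≠ 0 := (mul_pos (by linarith) ht.1).ne'
    exact memLp_biotSavart (contDiff_thinned ha hσS) (hasCompactSupport_thinned ha hσc)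
      ((integral_thinned ha _).trans hσm)
  · refine tendsto_l2Norm_thinned hσS hσc hσm (fun x₂ => ?_) ht.1
    simp only [Pi.smul_apply]
    rw [integral_smul, h0, smul_zero]
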